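/- A left brace is a set $A$ with operations $+,\circ$ such that $(A,+)$ is an abelian group, $(A,\circ)$ is a group and $a\circ(b+c)+a=a\circ b+a\circ c$ for all $a,b,c$; put $a*b=a\circ b-a-b$. It is a $\mathbb Q$-brace if $(A,+)$ is a $\mathbb Q$-vector space and $a*(eb)=e(a*b)$ for all $a,b\in A$, $e\in\mathbb Q$. Put $A^{[1]}=A$ and, for $i\ge 2$, let $A^{[i]}$ be the set of sums of elements $a*b$ with $a\in A^{[j]}$, $b\in A^{[i-j]}$, $0<j<i$; $A$ is strongly nilpotent if $A^{[n]}=0$ for some $n$. A sequence in a $\mathbb Q$-vector space converges to $l$ if the sequence and $l$ lie in a finite-dimensional subspace in which the sequence converges coordinatewise to $l$, for the usual topology of $\mathbb Q$. **Theorem.** Let $(A,+,\circ)$ be a strongly nilpotent $\mathbb Q$-brace (of any dimension). For all $a,b\in A$ the limit $$a\cdot b=\lim_{n\to\infty}2^n\Big(\big(\tfrac1{2^n}a\big)*b\Big)$$ exists and is unique, and $(A,+,\cdot)$ is a nilpotent pre-Lie algebra over $\mathbb Q$: the product is bilinear, $(x\cdot y)\cdot z-x\cdot(y\cdot z)=(y\cdot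 x)\cdot z-y\cdot(x\cdot z)$, and for some $n$ all products of $n$ or more elements, with any bracketing, are zero. Write $L_a(b)=a\cdot b$, $e^{L_a}(b)=\sum_{k\ge0}\frac1{k!}L_a^k(b)$ and $W(a)=\sum_{k\ge0}\frac1{(k+1)!}L_a^k(a)=a+\frac1{2!}a\cdot a+\frac1{3!}a\cdot(a\cdot a)+\cdots$. Then $W:A\to A$ is bijective and, with $\Omega=W^{-1}$, $$a\circ b=a+e^{L_{\Omega(a)}}(b)\qquad\text{for all }a,b\in A,$$ that is, $(A,\circ)$ is the group of flows of the pre-Lie algebra $(A,+,\cdot)$. Moreover there are rational coefficients $\beta_w$, which do not depend on the brace $A$ or on $a,b$, indexed by the bracketed words $w$ in two letters in which the second letter occurs exactly once, at the end, and the first letter occurs at least twice, such that for every such $A$ and all $a,b\in A$ $$a*b=a\cdot b+\sum_w\beta_w\,w(a,b),$$ where $w(a,b)$ is the value of $w$ at $(a,b)$ under the product $\cdot$, and only finitely many terms of the sum are nonzero. -/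

import Mathlib

open Filter Topology

universe u

/-- A left brace: an abelian group `(A, +)` and a group `(A, ∘)`, the latter written with Mathlib's
multiplication (so `a * b` in Lean is `a ∘ b`), such that `a ∘ (b + c) + a = a ∘ b + a ∘ c`. -/
class LeftBrace (A : Type u) extends AddCommGroup A, Group A where
  circ_add : ∀ a b c : A, a * (b + c) + a = a * b + a * c

/-- The operation `a ∘ b - a - b` of a brace (written `a * b` in the literature on braces). -/
def braceStar {A : Type u} [LeftBrace A] (a b : A) : A := a * b - a - b

/-- An `F`-brace: a left brace with an `F`-vector space structure on `(A, +)` for which `braceStar`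
commutes with scalars in its second argument. -/
class LinearBrace (F : Type*) [Field F] (A : Type u) [LeftBrace A] extends Module F A where
  braceStar_smul : ∀ (a b : A) (e : F), braceStar a (e • b) = e • braceStar a b

/-- The chain `A^[i]`: `A^[1] = A`, and for `i ≥ 2`, `A^[i]` is the additive subgroup generated by
the elements `braceStar a b` with `a ∈ A^[j]`, `b ∈ A^[i - j]`, `0 < j < i`.
(The index `0` is not used; its value is `A`.) -/
def strongSeries (A : Type u) [LeftBrace A] : ℕ → AddSubgroup A
  | 0 => ⊤
  | 1 => ⊤
  | (i + 2) => AddSubgroup.closure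
      {x | ∃ j : Fin (i + 1), ∃ a ∈ strongSeries A (j.1 + 1), ∃ b ∈ strongSeries A (i + 1 - j.1),
        braceStar a b = x}
  termination_by i => i
  decreasing_by all_goals omega

/-- A left brace is strongly nilpotent if `A^[n] = 0` for some `n`. -/
def StronglyNilpotent (A : Type u) [LeftBrace A] : Prop := ∃ n : ℕ, strongSeries A n = ⊥

/-- Convergence of a sequence in a (possibly infinite-dimensional) rational vector space: the
sequence and its limit lie in the span of finitely many vectors, and the sequence converges there
coordinatewise, for the usual topology of `ℚ`. -/
def FinConverges {V : Type u} [AddCommGroup V] [Module ℚ V] (f : ℕ → V) (l : V) : Prop :=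
  ∃ (k : ℕ) (v : Fin k → V) (c : ℕ → Fin k → ℚ) (c' : Fin k → ℚ),
    (∀ i, Tendsto (fun n => c n i) atTop (𝓝 (c' i))) ∧
    (∀ n, f n = ∑ i, c n i • v i) ∧ l = ∑ i, c' i • v i

/-- `dot a b = lim 2^n ((1/2^n) a) * b`, where `*` is `braceStar`. -/
def IsLimitProduct {A : Type u} [LeftBrace A] [LinearBrace ℚ A] (dot : A → A → A) : Prop :=
  ∀ a b : A,
    FinConverges (fun n : ℕ => (2 ^ n : ℚ) • braceStar ((1 / 2 ^ n : ℚ) • a) b) (dot a b)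

/-- The value of a bracketed word under the product `dot`, with letters evaluated by `f`. -/
def evalWord {X : Type*} {A : Type u} (dot : A → A → A) (f : X → A) : FreeMagma X → A
  | .of x => f x
  | .mul u v => dot (evalWord dot f u) (evalWord dot f v)

/-- The letters of a bracketed word, from left to right. -/
def wordLetters {X : Type*} : FreeMagma X → List X
  | .of x => [x]
  | .mul u v => wordLetters u ++ wordLetters v

section PreLie

variable {A : Type u} [AddCommGroup A] [Module ℚ A]

/-- `(A, +, dot)` is a (left) pre-Lie algebra over `ℚ`. -/
structure IsPreLieProduct (dot : A → A → A) : Prop where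
  add_left : ∀ x y z : A, dot (x + y) z = dot x z + dot y z
  add_right : ∀ x y z : A, dot x (y + z) = dot x y + dot x z
  smul_left : ∀ (t : ℚ) (x y : A), dot (t • x) y = t • dot x y
  smul_right : ∀ (t : ℚ) (x y : A), dot x (t • y) = t • dot x y
  pre_lie : ∀ x y z : A,
    dot (dot x y) z - dot x (dot y z) = dot (dot y x) z - dot y (dot x z)

/-- For some `n`, all products of at least `n` elements, with any bracketing, are zero. -/
def IsNilpotentProduct (dot : A → A → A) : Prop :=
  ∃ n : ℕ, ∀ w : FreeMagma A, n ≤ w.length → evalWord dot id w = 0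

/-- `e^{L_x}(b) = b + x·b + (1/2!) x·(x·b) + ⋯`. -/
noncomputable def expLeft (dot : A → A → A) (x b : A) : A :=
  ∑ᶠ k : ℕ, ((k.factorial : ℚ)⁻¹) • (dot x)^[k] b

/-- `W(a) = e^{L_a}(1) - 1 = a + (1/2!) a·a + (1/3!) a·(a·a) + ⋯`, for a formal unit `1`. -/
noncomputable def flowW (dot : A → A → A) (a : A) : A :=
  ∑ᶠ k : ℕ, (((k + 1).factorial : ℚ)⁻¹) • (dot a)^[k] a

/-- `Ω`, the inverse function of `W`. -/
noncomputable def flowOmega (dot : A → A → A) : A → A := Function.invFun (flowW dot)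

/-- The multiplication `a + e^{L_{Ω(a)}}(b)` of the group of flows. -/
noncomputable def flowMul (dot : A → A → A) (a b : A) : A := a + expLeft dot (flowOmega dot a) b

/-- Bracketed words in two letters `a` (`false`) and `b` (`true`) in which `b` occurs exactly once,
at the end, and `a` occurs at least twice. -/
def longWords : Set (FreeMagma Bool) :=
  {w | ∃ k : ℕ, 2 ≤ k ∧ wordLetters w = List.replicate k false ++ [true]}

/-- The value under `dot` of a word in the letters `a` (`false`) and `b` (`true`). -/
def evalPair (dot : A → A → A) (a b : A) (w : FreeMagma Bool) : A :=
  evalWord dot (fun i => if i then b else a) w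

end PreLie

/-! ### The linear representation λ of the circle group -/

section Brace

variable {A : Type u} [LeftBrace A]

/-! The maps λ_a(b) = a ∘ b - a are linear and multiplicative in a, so (A, ∘) acts on A × ℚ by (v,
s) ↦ (λ_a(v) + s a, s); strong nilpotency makes this action (`affineRep`) unipotent. The theorem is
Lie theory for this group, with polynomial curves over ℚ in place of analysis.

The binomial series defines rational powers of a unipotent operator. They stay in the image of A
because (A, ∘) has roots (`exists_root`): x ↦ x^q is q times the identity to first order along the
strong series. Hence every a lies on a one-parameter subgroup that is polynomial in t
(`affineRep_oneParam`).

The star is not additive on the left, so it is not evident that (ta) * b is polynomial in t. This is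
the central point, `polyStar_of_mem`: one-parameter subgroups are split off a polynomial curve,
modulo deeper terms of the strong series. The limit product is then the linear coefficient of (ta) *
b. Its additivity on the left follows from the chain rule `hasJet_comp`, and the pre-Lie identity is
the derivative of its equivariance under conjugation, `dot_lam`.

Let x be the velocity at 0 of the one-parameter subgroup through a. Uniqueness for a linear
differential equation gives `affineRep a` as the exponential of the generator attached to x
(`affineRep_eq_exp`). Applied to (0, 1) this says a = W(x), and applied to (b, 0) it says λ_a =
e^{L_x}. As W is the identity to first order, it is bijective, and x = Ω(a). Solving W(Ω) = a
recursively over bracketed words yields coefficients that depend on no brace. -/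

theorem brace_mul_zero (a : A) : a * (0 : A) = a := by
  have h := LeftBrace.circ_add a 0 0
  rw [add_zero] at h
  exact (add_left_cancel h).symm

theorem brace_one_eq_zero : (1 : A) = 0 := by
  have h := brace_mul_zero (1 : A)
  rw [one_mul] at h
  exact h.symm

theorem braceStar_add (a b c : A) : braceStar a (b + c) = braceStar a b + braceStar a c := by
  have h := eq_sub_of_add_eq (LeftBrace.circ_add a b c)
  unfold braceStar
  rw [h]
  abel

theorem mul_eq_add_braceStar (a b : A) : a * b = a + b + braceStar a b := by
  unfold braceStar
  abel

variable [LinearBrace ℚ A]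

/-- The map `b ↦ a * b` of a `ℚ`-brace as a linear endomorphism. -/
def starLin (a : A) : Module.End ℚ A where
  toFun := braceStar a
  map_add' := braceStar_add a
  map_smul' e b := LinearBrace.braceStar_smul a b e

/-- The endomorphisms `λ_a(b) = a ∘ b - a`. -/
def lam : A →* Module.End ℚ A where
  toFun a := 1 + starLin a
  map_one' := by
    ext b
    simp only [starLin, braceStar, LinearMap.add_apply, LinearMap.coe_mk, AddHom.coe_mk, one_mul]
    rw [brace_one_eq_zero]
    simp
  map_mul' a b := by
    have key : ∀ a b : A, (1 + starLin a : Module.End ℚ A) b = a * b - a := by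
      intro a b
      simp [starLin, braceStar]
    ext c
    rw [Module.End.mul_apply, key b, map_sub, key, key, key, mul_assoc]
    abel

theorem lam_apply (a b : A) : lam a b = b + braceStar a b := rfl

theorem starLin_apply (a b : A) : starLin a b = braceStar a b := rfl

theorem mul_eq_add_lam (a b : A) : a * b = a + lam a b := by
  rw [mul_eq_add_braceStar, lam_apply, add_assoc]

theorem lam_zero : lam (0 : A) = 1 := by
  rw [← brace_one_eq_zero, map_one]

theorem braceStar_zero_left (b : A) : braceStar (0 : A) b = 0 := by
  have h := congrArg (fun T : Module.End ℚ A => T b) (lam_zero (A := A))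
  simpa [lam_apply] using h

theorem lam_lam_inv (a b : A) : lam a (lam a⁻¹ b) = b := by
  rw [← Module.End.mul_apply, ← map_mul, mul_inv_cancel, map_one, Module.End.one_apply]

/-- A sum rewritten as a product for the circle operation. -/
theorem add_eq_mul_lam_inv (a b : A) : a + b = a * lam a⁻¹ b := by
  rw [mul_eq_add_lam, lam_lam_inv]

theorem brace_inv_eq (a : A) : a⁻¹ = -lam a⁻¹ a := by
  have h := mul_eq_add_lam a⁻¹ a
  rw [inv_mul_cancel, brace_one_eq_zero] at h
  exact eq_neg_of_add_eq_zero_left h.symm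

/-- This is λ_{a ∘ b} = λ_a λ_b in terms of the star. It replaces additivity in the left argument:
sums are rewritten as circle products, and the composite term is of higher order. -/
theorem braceStar_mul (a b c : A) :
    braceStar (a * b) c = braceStar a c + braceStar b c + braceStar a (braceStar b c) := by
  have h := congrArg (fun T : Module.End ℚ A => T c) (map_mul lam a b)
  simp only [Module.End.mul_apply, lam_apply, braceStar_add] at h
  have h' := add_left_cancel (h.trans (add_assoc _ _ _))
  rw [h']
  abel

end Brace

/-! ### The strong series as a filtration, and roots in (A, ∘) -/

section Filtration

variable (A : Type u) [LeftBrace A]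

theorem strongSeries_add_two (i : ℕ) : strongSeries A (i + 2) = AddSubgroup.closure
      {x | ∃ j : Fin (i + 1), ∃ a ∈ strongSeries A (j.1 + 1), ∃ b ∈ strongSeries A (i + 1 - j.1),
        braceStar a b = x} := by
  rw [strongSeries]

variable {A} in
theorem braceStar_mem_of_pos {i j : ℕ} (hi : 1 ≤ i) (hj : 1 ≤ j) {a b : A}
    (ha : a ∈ strongSeries A i) (hb : b ∈ strongSeries A j) :
    braceStar a b ∈ strongSeries A (i + j) := by
  obtain ⟨i, rfl⟩ := Nat.exists_eq_add_of_le' hi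
  obtain ⟨j, rfl⟩ := Nat.exists_eq_add_of_le' hj
  rw [show i + 1 + (j + 1) = (i + j) + 2 by ring, strongSeries_add_two]
  apply AddSubgroup.subset_closure
  refine ⟨⟨i, by omega⟩, a, ha, b, ?_, rfl⟩
  simpa [show i + j + 1 - i = j + 1 by omega] using hb

theorem strongSeries_succ_le (i : ℕ) : strongSeries A (i + 1) ≤ strongSeries A i := by
  induction i using Nat.strong_induction_on with
  | _ i ih =>
    match i with
    | 0 => simp [strongSeries]
    | 1 => simp [strongSeries]
    | (i + 2) =>
      rw [show i + 2 + 1 = (i + 1) + 2 by ring, strongSeries_add_two A (i + 1),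
        AddSubgroup.closure_le]
      rintro x ⟨⟨j, hj⟩, a, ha, b, hb, rfl⟩
      simp only at ha hb
      -- One factor is moved a step up the chain: the left one if its index exceeds 1, otherwise the
      -- right one.
      rcases Nat.eq_zero_or_pos j with rfl | hj0
      · have := ih (i + 1) (by omega) (x := b) (by simpa using hb)
        have h2 := braceStar_mem_of_pos (by omega) (by omega) ha this
        rwa [show 0 + 1 + (i + 1) = i + 2 by ring] at h2
      · have := ih j (by omega) ha
        have h2 := braceStar_mem_of_pos (by omega) (by omega) this hb
        rwa [show j + (i + 1 + 1 - j) = i + 2 by omega] at h2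

variable [LinearBrace ℚ A]

theorem smul_mem_strongSeries (i : ℕ) (e : ℚ) {a : A} (ha : a ∈ strongSeries A i) :
    e • a ∈ strongSeries A i := by
  induction i using Nat.strong_induction_on generalizing a with
  | _ i ih =>
    match i with
    | 0 => simp [strongSeries]
    | 1 => simp [strongSeries]
    | (i + 2) =>
      rw [strongSeries_add_two] at ha ⊢
      induction ha using AddSubgroup.closure_induction with
      | mem x hx =>
        obtain ⟨⟨j, hj⟩, a, ha, b, hb, rfl⟩ := hx
        apply AddSubgroup.subset_closure
        exact ⟨⟨j, hj⟩, a, ha, e • b, ih _ (by simp only; omega) hb,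
          LinearBrace.braceStar_smul a b e⟩
      | zero => simp
      | add x y _ _ hx hy => rw [smul_add]; exact add_mem hx hy
      | neg x _ hx => rw [smul_neg]; exact neg_mem hx

/-- The terms of the strong series of a `ℚ`-brace as linear subspaces. -/
def strongSub (i : ℕ) : Submodule ℚ A where
  carrier := strongSeries A i
  add_mem' := add_mem
  zero_mem' := zero_mem _
  smul_mem' e _ ha := smul_mem_strongSeries A i e ha

variable {A}

theorem strongSub_zero : strongSub A 0 = ⊤ := by
  ext x
  change x ∈ strongSeries A 0 ↔ _
  simp [strongSeries]

theorem strongSub_one : strongSub A 1 = ⊤ := by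
  ext x
  change x ∈ strongSeries A 1 ↔ _
  simp [strongSeries]

theorem mem_strongSub_one (x : A) : x ∈ strongSub A 1 := by
  rw [strongSub_one]; trivial

theorem strongSub_antitone : Antitone (strongSub A) :=
  antitone_nat_of_succ_le fun i => strongSeries_succ_le A i

theorem braceStar_mem {i j : ℕ} {a b : A} (ha : a ∈ strongSub A i) (hb : b ∈ strongSub A j) :
    braceStar a b ∈ strongSub A (i + j) := by
  -- Indices 0 and 1 both give the whole space, so the default value at 0 causes no exception.
  have key : ∀ {k : ℕ} {x : A}, x ∈ strongSub A k → x ∈ strongSub A (max k 1) := by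
    intro k x hx
    rcases Nat.eq_zero_or_pos k with rfl | hk
    · exact mem_strongSub_one x
    · rwa [max_eq_left hk]
  exact strongSub_antitone (show i + j ≤ max i 1 + max j 1 by omega)
    (braceStar_mem_of_pos (le_max_right _ _) (le_max_right _ _) (key ha) (key hb))

theorem braceStar_mem_succ (a : A) {j : ℕ} {b : A} (hb : b ∈ strongSub A j) :
    braceStar a b ∈ strongSub A (j + 1) := by
  rw [add_comm]
  exact braceStar_mem (mem_strongSub_one a) hb

theorem lam_mem (a : A) {j : ℕ} {b : A} (hb : b ∈ strongSub A j) : lam a b ∈ strongSub A j :=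
  add_mem hb (strongSub_antitone (Nat.le_succ j) (braceStar_mem_succ a hb))

/-- A map that is a homothety to first order along the strong series is bijective. -/
theorem bijective_of_approx {n : ℕ} (hn : strongSub A n = ⊥) (g : A → A) {r : ℚ} (hr : r ≠ 0)
    (hg : ∀ i x y, x - y ∈ strongSub A i → g x - g y - r • (x - y) ∈ strongSub A (i + 1)) :
    Function.Bijective g := by
  constructor
  · intro x y hxy
    have h : ∀ i, x - y ∈ strongSub A i := by
      intro i
      induction i with
      | zero => rw [strongSub_zero]; trivial
      | succ i ih =>
        have := hg i x y ih
        rw [hxy, sub_self, zero_sub, neg_mem_iff] at this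
        have h2 := Submodule.smul_mem _ r⁻¹ this
        rwa [smul_smul, inv_mul_cancel₀ hr, one_smul] at h2
    have := h n
    rw [hn, Submodule.mem_bot] at this
    exact sub_eq_zero.mp this
  · intro z
    have h : ∀ i, ∃ x, g x - z ∈ strongSub A i := by
      intro i
      induction i with
      | zero => exact ⟨0, by rw [strongSub_zero]; trivial⟩
      | succ i ih =>
        obtain ⟨x, hx⟩ := ih
        -- A Newton correction: it cancels the error modulo the next term of the series.
        refine ⟨x - r⁻¹ • (g x - z), ?_⟩
        have h1 := hg i (x - r⁻¹ • (g x - z)) x (by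
          rw [sub_sub_cancel_left]
          exact neg_mem (Submodule.smul_mem _ _ hx))
        rw [sub_sub_cancel_left, smul_neg, smul_smul, mul_inv_cancel₀ hr, one_smul] at h1
        convert h1 using 1
        abel
    obtain ⟨x, hx⟩ := h n
    rw [hn, Submodule.mem_bot] at hx
    exact ⟨x, sub_eq_zero.mp hx⟩

/-- Writing x = y ∘ u with u = λ_y⁻¹(x - y), the difference is exactly λ_y(u * b), and λ preserves
the filtration. -/
theorem braceStar_sub_left_mem {i j : ℕ} {x y b : A} (hxy : x - y ∈ strongSub A i)
    (hb : b ∈ strongSub A j) : braceStar x b - braceStar y b ∈ strongSub A (i + j) := by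
  have h : x = y * lam y⁻¹ (x - y) := by rw [← add_eq_mul_lam_inv]; abel
  have h2 : braceStar x b - braceStar y b = lam y (braceStar (lam y⁻¹ (x - y)) b) := by
    conv_lhs => rw [h, braceStar_mul]
    rw [lam_apply y]
    abel
  rw [h2]
  exact lam_mem _ (braceStar_mem (lam_mem _ hxy) hb)

/-- Modulo the next term of the series a circle product of such differences is a sum, so the q-th
circle power acts on them as multiplication by q. -/
theorem pow_sub_pow_mem (q i : ℕ) (x y : A) (hxy : x - y ∈ strongSub A i) :
    x ^ q - y ^ q - (q : ℚ) • (x - y) ∈ strongSub A (i + 1) := by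
  induction q with
  | zero => simp
  | succ q ih =>
    have h1 : x ^ q - y ^ q ∈ strongSub A i := by
      have := add_mem (strongSub_antitone (Nat.le_succ i) ih)
        (Submodule.smul_mem _ (q : ℚ) hxy)
      rwa [sub_add_cancel] at this
    have h2 := braceStar_mem_succ x h1
    have h3 := braceStar_sub_left_mem hxy (mem_strongSub_one (y ^ q))
    have h4 : braceStar x (x ^ q - y ^ q) = braceStar x (x ^ q) - braceStar x (y ^ q) :=
      map_sub (starLin x) _ _
    rw [h4] at h2
    have h5 := add_mem (add_mem ih h2) h3
    rw [pow_succ', pow_succ', mul_eq_add_braceStar x, mul_eq_add_braceStar y]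
    convert h5 using 1
    push_cast
    rw [add_smul, one_smul]
    abel

theorem exists_root {n : ℕ} (hn : strongSub A n = ⊥) {q : ℕ} (hq : q ≠ 0) (x : A) :
    ∃ y : A, y ^ q = x :=
  (bijective_of_approx hn (fun y : A => y ^ q) (Nat.cast_ne_zero.mpr hq)
    (pow_sub_pow_mem q)).2 x

end Filtration

/-! ### Polynomial curves, first-order jets and limits -/

section Curves

variable {V : Type*} [AddCommGroup V] [Module ℚ V] {V' : Type*} [AddCommGroup V'] [Module ℚ V']

/-- Polynomial curves `t ↦ ∑ t ^ m • v_m` with exponents `m ≥ k` and coefficients in `P`. -/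
def polyCurves (k : ℕ) (P : Submodule ℚ V) : Submodule ℚ (ℚ → V) :=
  Submodule.span ℚ {c | ∃ m, k ≤ m ∧ ∃ v ∈ P, c = fun t => t ^ m • v}

theorem zero_fun_mem_polyCurves {k : ℕ} {P : Submodule ℚ V} : (fun _ => 0) ∈ polyCurves k P :=
  zero_mem (polyCurves k P)

theorem add_fun_mem_polyCurves {k : ℕ} {P : Submodule ℚ V} {c d : ℚ → V} (hc : c ∈ polyCurves k P)
    (hd : d ∈ polyCurves k P) : (fun t => c t + d t) ∈ polyCurves k P :=
  add_mem hc hd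

/-- Every polynomial curve is a sum of monomials. -/
theorem mem_closure_of_mem_polyCurves {k : ℕ} {P : Submodule ℚ V} {c : ℚ → V}
    (hc : c ∈ polyCurves k P) :
    c ∈ AddSubmonoid.closure {c : ℚ → V | ∃ m, k ≤ m ∧ ∃ v ∈ P, c = fun t => t ^ m • v} := by
  induction hc using Submodule.span_induction with
  | mem x h => exact AddSubmonoid.subset_closure h
  | zero => exact zero_mem _
  | add x y _ _ hx hy => exact add_mem hx hy
  | smul a x hm hx =>
    clear hm
    induction hx using AddSubmonoid.closure_induction with
    | mem x h =>
      obtain ⟨m, hm, v, hv, rfl⟩ := h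
      refine AddSubmonoid.subset_closure ⟨m, hm, a • v, Submodule.smul_mem _ a hv, ?_⟩
      ext t
      exact smul_comm _ _ _
    | zero => rw [smul_zero]; exact zero_mem _
    | add x y _ _ hx hy => rw [smul_add]; exact add_mem hx hy

theorem monomial_mem_polyCurves {k m : ℕ} (hm : k ≤ m) {P : Submodule ℚ V} {v : V} (hv : v ∈ P) :
    (fun t : ℚ => t ^ m • v) ∈ polyCurves k P :=
  Submodule.subset_span ⟨m, hm, v, hv, rfl⟩

theorem const_mem_polyCurves {P : Submodule ℚ V} {v : V} (hv : v ∈ P) :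
    (fun _ : ℚ => v) ∈ polyCurves 0 P := by
  simpa using monomial_mem_polyCurves (le_refl 0) hv

theorem linear_mem_polyCurves {P : Submodule ℚ V} {v : V} (hv : v ∈ P) :
    (fun t : ℚ => t • v) ∈ polyCurves 1 P := by
  simpa using monomial_mem_polyCurves (le_refl 1) hv

theorem polyCurves_mono {k k' : ℕ} (hk : k' ≤ k) {P P' : Submodule ℚ V} (hP : P ≤ P') :
    polyCurves k P ≤ polyCurves k' P' :=
  Submodule.span_mono fun _ ⟨m, hm, v, hv, h⟩ => ⟨m, hk.trans hm, v, hP hv, h⟩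

theorem smul_mem_polyCurves {k : ℕ} {P : Submodule ℚ V} (m : ℕ) {c : ℚ → V}
    (hc : c ∈ polyCurves k P) : (fun t => t ^ m • c t) ∈ polyCurves (k + m) P := by
  induction hc using Submodule.span_induction with
  | mem x h =>
    obtain ⟨l, hl, v, hv, rfl⟩ := h
    simp only [smul_smul, ← pow_add]
    exact monomial_mem_polyCurves (by omega) hv
  | zero => simpa using zero_fun_mem_polyCurves
  | add x y _ _ hx hy => simpa using add_fun_mem_polyCurves hx hy
  | smul a x _ hx =>
    have := Submodule.smul_mem _ a hx
    convert this using 1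
    ext t
    simp only [Pi.smul_apply]
    rw [smul_comm]

/-- A family of linear maps depending polynomially on `t`, applied to a polynomial curve. -/
theorem apply_mem_polyCurves {k m : ℕ} {P : Submodule ℚ V} {P' : Submodule ℚ V'}
    {T : ℚ → V →ₗ[ℚ] V'} (hT : ∀ v ∈ P, (fun t => T t v) ∈ polyCurves k P') {c : ℚ → V}
    (hc : c ∈ polyCurves m P) : (fun t => T t (c t)) ∈ polyCurves (k + m) P' := by
  induction hc using Submodule.span_induction with
  | mem x h =>
    obtain ⟨l, hl, v, hv, rfl⟩ := h
    simp only [map_smul]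
    exact polyCurves_mono (by omega) le_rfl (smul_mem_polyCurves l (hT v hv))
  | zero => simpa using zero_fun_mem_polyCurves
  | add x y _ _ hx hy => simpa using add_fun_mem_polyCurves hx hy
  | smul a x _ hx =>
    have := Submodule.smul_mem _ a hx
    convert this using 1
    ext t
    simp

theorem map_mem_polyCurves {m : ℕ} {P : Submodule ℚ V} {P' : Submodule ℚ V'}
    (T : V →ₗ[ℚ] V') (hT : ∀ v ∈ P, T v ∈ P') {c : ℚ → V}
    (hc : c ∈ polyCurves m P) : (fun t => T (c t)) ∈ polyCurves m P' := by
  simpa using apply_mem_polyCurves (T := fun _ => T) (fun v hv => const_mem_polyCurves (hT v hv)) hc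

/-- Without a constant term, every exponent that occurs is a positive multiple of m. -/
theorem eval_smul_mem_polyCurves {k m : ℕ} (hkm : k ≤ m) (p : Polynomial ℚ) (hp : p.coeff 0 = 0)
    {P : Submodule ℚ V} {v : V} (hv : v ∈ P) :
    (fun t : ℚ => p.eval (t ^ m) • v) ∈ polyCurves k P := by
  have h : (fun t : ℚ => p.eval (t ^ m) • v)
      = ∑ i ∈ p.support, p.coeff i • fun t : ℚ => t ^ (m * i) • v := by
    ext t
    rw [Polynomial.eval_eq_sum, Polynomial.sum, Finset.sum_smul, Finset.sum_apply]
    refine Finset.sum_congr rfl fun i _ => ?_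
    simp [smul_smul, pow_mul]
  rw [h]
  refine sum_mem fun i hi => Submodule.smul_mem _ _ (monomial_mem_polyCurves ?_ hv)
  have : i ≠ 0 := by
    rintro rfl
    exact Polynomial.mem_support_iff.mp hi hp
  exact hkm.trans (Nat.le_mul_of_pos_right m (Nat.pos_of_ne_zero this))

theorem eval_smul_mem_polyCurves_zero (p : Polynomial ℚ) {P : Submodule ℚ V} {v : V} (hv : v ∈ P) :
    (fun t : ℚ => p.eval t • v) ∈ polyCurves 0 P := by
  have h : (fun t : ℚ => p.eval t • v) = ∑ i ∈ p.support, p.coeff i • fun t : ℚ => t ^ i • v := by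
    ext t
    rw [Polynomial.eval_eq_sum, Polynomial.sum, Finset.sum_smul, Finset.sum_apply]
    exact Finset.sum_congr rfl fun i _ => by simp [smul_smul]
  rw [h]
  exact sum_mem fun i _ => Submodule.smul_mem _ _ (monomial_mem_polyCurves (Nat.zero_le _) hv)

/-- Precomposition with a polynomial function. -/
theorem comp_mem_polyCurves {P : Submodule ℚ V} (q : Polynomial ℚ) {c : ℚ → V}
    (hc : c ∈ polyCurves 0 P) : (fun t => c (q.eval t)) ∈ polyCurves 0 P := by
  induction hc using Submodule.span_induction with
  | mem x h =>
    obtain ⟨l, hl, v, hv, rfl⟩ := h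
    simpa using eval_smul_mem_polyCurves_zero (q ^ l) hv
  | zero => exact zero_mem (polyCurves 0 P)
  | add x y _ _ hx hy => exact add_mem hx hy
  | smul a x _ hx => exact Submodule.smul_mem _ a hx

theorem comp_mul_mem_polyCurves {k : ℕ} {P : Submodule ℚ V} (s : ℚ) {c : ℚ → V}
    (hc : c ∈ polyCurves k P) : (fun t => c (s * t)) ∈ polyCurves k P := by
  induction hc using Submodule.span_induction with
  | mem x h =>
    obtain ⟨l, hl, v, hv, rfl⟩ := h
    simp only [mul_pow, mul_smul]
    exact Submodule.smul_mem _ (s ^ l) (monomial_mem_polyCurves hl hv)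
  | zero => exact zero_mem (polyCurves k P)
  | add x y _ _ hx hy => exact add_mem hx hy
  | smul a x _ hx => exact Submodule.smul_mem _ a hx

theorem exists_polynomial_of_mem_polyCurves {k : ℕ} {P : Submodule ℚ V} {c : ℚ → V}
    (hc : c ∈ polyCurves k P) (φ : V →ₗ[ℚ] ℚ) :
    ∃ p : Polynomial ℚ, ∀ t, φ (c t) = t ^ k * p.eval t := by
  induction hc using Submodule.span_induction with
  | mem x h =>
    obtain ⟨l, hl, v, hv, rfl⟩ := h
    refine ⟨Polynomial.C (φ v) * Polynomial.X ^ (l - k), fun t => ?_⟩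
    have : t ^ l = t ^ k * t ^ (l - k) := by rw [← pow_add, Nat.add_sub_cancel' hl]
    simp [this]
    ring
  | zero => exact ⟨0, by simp⟩
  | add x y _ _ hx hy =>
    obtain ⟨p, hp⟩ := hx
    obtain ⟨q, hq⟩ := hy
    exact ⟨p + q, fun t => by simp [hp, hq]; ring⟩
  | smul a x _ hx =>
    obtain ⟨p, hp⟩ := hx
    exact ⟨Polynomial.C a * p, fun t => by simp [hp]; ring⟩

theorem eq_zero_of_forall_dual {v : V} (h : ∀ φ : V →ₗ[ℚ] ℚ, φ v = 0) : v = 0 :=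
  (Module.forall_dual_apply_eq_zero_iff ℚ v).mp h

/-- A polynomial curve vanishing at the natural numbers vanishes. -/
theorem eq_zero_of_forall_nat {P : Submodule ℚ V} {c : ℚ → V}
    (hc : c ∈ polyCurves 0 P) (h : ∀ m : ℕ, c m = 0) (t : ℚ) : c t = 0 := by
  refine eq_zero_of_forall_dual fun φ => ?_
  obtain ⟨p, hp⟩ := exists_polynomial_of_mem_polyCurves hc φ
  have hp0 : p = 0 := by
    refine Polynomial.eq_of_infinite_eval_eq _ _ ((Set.infinite_range_of_injective
      (Nat.cast_injective (R := ℚ))).mono ?_)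
    rintro _ ⟨m, rfl⟩
    have := hp m
    simp only [h, map_zero, pow_zero, one_mul] at this
    simp [← this]
  rw [hp, hp0]
  simp

theorem eq_of_forall_nat {P : Submodule ℚ V} {c d : ℚ → V}
    (hc : c ∈ polyCurves 0 P) (hd : d ∈ polyCurves 0 P) (h : ∀ m : ℕ, c m = d m) : c = d := by
  ext t
  exact sub_eq_zero.mp (eq_zero_of_forall_nat (sub_mem hc hd) (fun m => sub_eq_zero.mpr (h m)) t)

/-- The curve `c` equals `v₀ + t • v₁` up to polynomial terms of order at least two. -/
def HasJet (c : ℚ → V) (v₀ v₁ : V) : Prop :=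
  (fun t => c t - v₀ - t • v₁) ∈ polyCurves 2 (⊤ : Submodule ℚ V)

theorem HasJet.unique {c : ℚ → V} {v₀ v₁ w₀ w₁ : V} (h : HasJet c v₀ v₁) (h' : HasJet c w₀ w₁) :
    v₀ = w₀ ∧ v₁ = w₁ := by
  have key : ∀ φ : V →ₗ[ℚ] ℚ, φ (v₀ - w₀) = 0 ∧ φ (v₁ - w₁) = 0 := by
    intro φ
    obtain ⟨p, hp⟩ := exists_polynomial_of_mem_polyCurves (sub_mem h' h) φ
    have h0 : Polynomial.C (φ (v₀ - w₀)) + Polynomial.C (φ (v₁ - w₁)) * Polynomial.X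
        = Polynomial.X ^ 2 * p := by
      refine Polynomial.funext fun t => ?_
      have := hp t
      simp only [Pi.sub_apply, map_sub, map_smul, smul_eq_mul] at this
      simp
      linarith
    have e0 := congrArg (fun q => Polynomial.coeff q 0) h0
    have e1 := congrArg (fun q => Polynomial.coeff q 1) h0
    simp only [Polynomial.coeff_add, Polynomial.coeff_C_zero, Polynomial.mul_coeff_zero,
      Polynomial.coeff_X_zero, mul_zero, add_zero, Polynomial.coeff_X_pow] at e0
    simp only [Polynomial.coeff_add, Polynomial.coeff_C_mul, Polynomial.coeff_X_one, mul_one,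
      Polynomial.coeff_C_succ, zero_add, Polynomial.coeff_X_pow_mul'] at e1
    exact ⟨by simpa using e0, by simpa using e1⟩
  exact ⟨sub_eq_zero.mp (eq_zero_of_forall_dual fun φ => (key φ).1),
    sub_eq_zero.mp (eq_zero_of_forall_dual fun φ => (key φ).2)⟩

theorem HasJet.add {c d : ℚ → V} {v₀ v₁ w₀ w₁ : V} (h : HasJet c v₀ v₁) (h' : HasJet d w₀ w₁) :
    HasJet (fun t => c t + d t) (v₀ + w₀) (v₁ + w₁) := by
  have := add_mem h h'
  unfold HasJet
  convert this using 1
  ext t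
  simp only [Pi.add_apply, smul_add]
  abel

theorem HasJet.map (T : V →ₗ[ℚ] V') {c : ℚ → V} {v₀ v₁ : V} (h : HasJet c v₀ v₁) :
    HasJet (fun t => T (c t)) (T v₀) (T v₁) := by
  have := map_mem_polyCurves (P' := ⊤) T (fun _ _ => trivial) h
  unfold HasJet
  simpa using this

theorem HasJet.neg {c : ℚ → V} {v₀ v₁ : V} (h : HasJet c v₀ v₁) :
    HasJet (fun t => -c t) (-v₀) (-v₁) :=
  h.map (-LinearMap.id)

theorem hasJet_const (v : V) : HasJet (fun _ => v) v 0 := by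
  unfold HasJet
  simpa using zero_fun_mem_polyCurves

theorem hasJet_linear (v : V) : HasJet (fun t => t • v) 0 v := by
  unfold HasJet
  simpa using zero_fun_mem_polyCurves

theorem hasJet_of_mem {c : ℚ → V} (h : c ∈ polyCurves 2 (⊤ : Submodule ℚ V)) : HasJet c 0 0 := by
  unfold HasJet
  simpa using h

theorem hasJet_monomial {m : ℕ} (v : V) : HasJet (fun t : ℚ => t ^ (m + 2) • v) 0 0 :=
  hasJet_of_mem (monomial_mem_polyCurves (by omega) trivial)

theorem HasJet.mem {c : ℚ → V} {v₀ v₁ : V} (h : HasJet c v₀ v₁) :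
    c ∈ polyCurves 0 (⊤ : Submodule ℚ V) := by
  have h1 := add_mem (polyCurves_mono (Nat.zero_le 2) le_rfl h)
    (add_mem (const_mem_polyCurves (P := ⊤) (v := v₀) trivial)
      (polyCurves_mono (Nat.zero_le 1) le_rfl
        (linear_mem_polyCurves (P := (⊤ : Submodule ℚ V)) (v := v₁) trivial)))
  convert h1 using 1
  ext t
  simp

theorem HasJet.mem_one {c : ℚ → V} {v₁ : V} (h : HasJet c 0 v₁) :
    c ∈ polyCurves 1 (⊤ : Submodule ℚ V) := by
  have h1 := add_mem (polyCurves_mono (show 1 ≤ 2 by omega) le_rfl h)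
    (linear_mem_polyCurves (P := (⊤ : Submodule ℚ V)) (v := v₁) trivial)
  convert h1 using 1
  ext t
  simp

/-- Application of a family of linear maps to a curve, to first order. -/
theorem HasJet.apply {T : ℚ → V →ₗ[ℚ] V'} {T₁ T₂ : V → V'}
    (hT : ∀ v, HasJet (fun t => T t v) (T₁ v) (T₂ v))
    {c : ℚ → V} {v₀ v₁ : V} (hc : HasJet c v₀ v₁) :
    HasJet (fun t => T t (c t)) (T₁ v₀) (T₁ v₁ + T₂ v₀) := by
  -- The curve c is split into its remainder of order two, v₀ and t v₁; T_t is applied to each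
  -- piece.
  have h1 := apply_mem_polyCurves (k := 0) (P' := ⊤) (fun v _ => (hT v).mem) hc
  have h2 : HasJet (fun t => t • T t v₁) 0 (T₁ v₁) := by
    have a1 := smul_mem_polyCurves 1 (hT v₁)
    have a2 := add_mem (polyCurves_mono (show 2 ≤ 2 + 1 by omega) le_rfl a1)
      (monomial_mem_polyCurves (le_refl 2) (P := ⊤) (v := T₂ v₁) trivial)
    unfold HasJet
    convert a2 using 1
    ext t
    simp only [Pi.add_apply, pow_one, smul_sub, smul_smul, sub_zero]
    rw [← sq]
    abel
  have h3 := (hasJet_of_mem (by simpa using h1)).add ((hT v₀).add h2)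
  convert h3 using 1
  · ext t
    abel
  · simp
  · simp [add_comm]

theorem exists_hasJet {k : ℕ} {P : Submodule ℚ V} {c : ℚ → V} (hc : c ∈ polyCurves k P) :
    ∃ v₀ ∈ P, ∃ v₁ ∈ P, HasJet c v₀ v₁ ∧ (1 ≤ k → v₀ = 0) := by
  induction hc using Submodule.span_induction with
  | mem x h =>
    obtain ⟨l, hl, v, hv, rfl⟩ := h
    match l with
    | 0 => exact ⟨v, hv, 0, zero_mem _, by simpa using hasJet_const v, by omega⟩
    | 1 => exact ⟨0, zero_mem _, v, hv, by simpa using hasJet_linear v, fun _ => rfl⟩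
    | l + 2 => exact ⟨0, zero_mem _, 0, zero_mem _, hasJet_monomial v, fun _ => rfl⟩
  | zero => exact ⟨0, zero_mem _, 0, zero_mem _, hasJet_const 0, fun _ => rfl⟩
  | add x y _ _ hx hy =>
    obtain ⟨v₀, h₀, v₁, h₁, h, h'⟩ := hx
    obtain ⟨w₀, g₀, w₁, g₁, g, g'⟩ := hy
    exact ⟨_, add_mem h₀ g₀, _, add_mem h₁ g₁, h.add g, fun hk => by rw [h' hk, g' hk, add_zero]⟩
  | smul a x _ hx =>
    obtain ⟨v₀, h₀, v₁, h₁, h, h'⟩ := hx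
    exact ⟨_, Submodule.smul_mem _ a h₀, _, Submodule.smul_mem _ a h₁,
      h.map (a • LinearMap.id), fun hk => by rw [h' hk, smul_zero]⟩

/-- A polynomial curve whose derivative vanishes everywhere is constant. -/
theorem eq_const_of_hasJet {c : ℚ → V} (h : ∀ s, HasJet (fun t => c (s + t)) (c s) 0) (t : ℚ) :
    c t = c 0 := by
  refine sub_eq_zero.mp (eq_zero_of_forall_dual fun φ => ?_)
  have hc : c ∈ polyCurves 0 (⊤ : Submodule ℚ V) := by simpa using (h 0).mem
  obtain ⟨p, hp⟩ := exists_polynomial_of_mem_polyCurves hc φ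
  simp only [pow_zero, one_mul] at hp
  have hd : Polynomial.derivative p = 0 := by
    refine Polynomial.funext fun s => ?_
    obtain ⟨q, hq⟩ := exists_polynomial_of_mem_polyCurves (h s) φ
    -- The linear coefficient of the Taylor expansion at s is p'(s), which is thus zero.
    have e : Polynomial.taylor s p = Polynomial.C (p.eval s) + Polynomial.X ^ 2 * q := by
      refine Polynomial.funext fun t => ?_
      have := hq t
      simp only [map_sub, hp, smul_zero, sub_zero] at this
      rw [Polynomial.taylor_eval]
      simp
      rw [add_comm t s]
      linarith
    have e1 := congrArg (fun r => Polynomial.coeff r 1) e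
    simpa [Polynomial.taylor_coeff_one, Polynomial.coeff_X_pow_mul', Polynomial.coeff_C] using e1
  have := Polynomial.eq_C_of_natDegree_eq_zero (Polynomial.derivative_eq_zero.mp hd)
  rw [map_sub, hp, hp, this]
  simp

/-- The two limits may come with different finite families of vectors; linear functionals turn both
into limits in ℚ, and they separate points. -/
theorem FinConverges.unique {f : ℕ → V} {l l' : V} (h : FinConverges f l) (h' : FinConverges f l') :
    l = l' := by
  have key : ∀ (l : V), FinConverges f l → ∀ φ : V →ₗ[ℚ] ℚ,
      Tendsto (fun n => φ (f n)) atTop (𝓝 (φ l)) := by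
    rintro l ⟨k, v, c, c', hc, hf, rfl⟩ φ
    simp only [hf, map_sum, map_smul, smul_eq_mul]
    exact tendsto_finsetSum _ fun i _ => (hc i).mul_const _
  exact sub_eq_zero.mp (eq_zero_of_forall_dual fun φ => by
    rw [map_sub, tendsto_nhds_unique (key l h φ) (key l' h' φ), sub_self])

theorem FinConverges.add {f g : ℕ → V} {l l' : V} (h : FinConverges f l) (h' : FinConverges g l') :
    FinConverges (fun n => f n + g n) (l + l') := by
  obtain ⟨k, v, c, c', hc, hf, rfl⟩ := h
  obtain ⟨k', w, d, d', hd, hg, rfl⟩ := h'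
  refine ⟨k + k', Fin.append v w, fun n => Fin.append (c n) (d n), Fin.append c' d', ?_, ?_, ?_⟩
  · intro i
    refine Fin.addCases (fun i => ?_) (fun i => ?_) i
    · simpa using hc i
    · simpa using hd i
  · intro n
    simp [Fin.sum_univ_add, hf, hg]
  · simp [Fin.sum_univ_add]

theorem finConverges_smul {c : ℕ → ℚ} {r : ℚ} (hc : Tendsto c atTop (𝓝 r)) (v : V) :
    FinConverges (fun n => c n • v) (r • v) :=
  ⟨1, fun _ => v, fun n _ => c n, fun _ => r, fun _ => hc, by simp, by simp⟩

theorem FinConverges.map (T : V →ₗ[ℚ] V') {f : ℕ → V} {l : V} (h : FinConverges f l) :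
    FinConverges (fun n => T (f n)) (T l) := by
  obtain ⟨k, v, c, c', hc, hf, rfl⟩ := h
  exact ⟨k, fun i => T (v i), c, c', hc, by simp [hf], by simp⟩

theorem tendsto_half_pow (m : ℕ) :
    Tendsto (fun n : ℕ => (2 ^ n : ℚ) * (1 / 2 ^ n : ℚ) ^ (m + 2)) atTop (𝓝 0) := by
  have h0 : Tendsto (fun n : ℕ => (1 / 2 : ℚ) ^ n) atTop (𝓝 0) :=
    tendsto_pow_atTop_nhds_zero_of_lt_one (by norm_num) (by norm_num)
  have h1 := h0.pow (m + 1)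
  rw [zero_pow (by omega)] at h1
  convert h1 using 2 with n
  rw [pow_succ _ (m + 1), mul_comm, mul_assoc, one_div_mul_cancel (by positivity), mul_one,
    one_div_pow, one_div_pow, one_div_pow]

/-- At t = 2⁻ⁿ a monomial of degree at least two still tends to zero after multiplication by 2ⁿ, so
only the velocity survives. -/
theorem finConverges_of_hasJet {c : ℚ → V} {v : V} (h : HasJet c 0 v) :
    FinConverges (fun n : ℕ => (2 ^ n : ℚ) • c (1 / 2 ^ n)) v := by
  have key : ∀ d ∈ polyCurves 2 (⊤ : Submodule ℚ V),
      FinConverges (fun n : ℕ => (2 ^ n : ℚ) • d (1 / 2 ^ n)) 0 := by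
    intro d hd
    induction hd using Submodule.span_induction with
    | mem x h =>
      obtain ⟨l, hl, v, hv, rfl⟩ := h
      obtain ⟨m, rfl⟩ := Nat.exists_eq_add_of_le' hl
      simpa [smul_smul] using finConverges_smul (tendsto_half_pow m) v
    | zero => simpa using finConverges_smul (tendsto_const_nhds (x := (0 : ℚ))) (0 : V)
    | add x y _ _ hx hy => simpa using hx.add hy
    | smul a x _ hx =>
      have := hx.map (a • LinearMap.id)
      simpa [smul_comm a] using this
  have h1 := (key _ h).add (finConverges_smul (tendsto_const_nhds (x := (1 : ℚ))) v)
  simpa [smul_sub, smul_smul] using h1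

end Curves

/-! ### Rational powers and one-parameter subgroups -/

section OneParameter

/-- The polynomial `binom(X, k)`. -/
noncomputable def choosePoly (k : ℕ) : Polynomial ℚ :=
  Polynomial.C ((k.factorial : ℚ)⁻¹) * descPochhammer ℚ k

theorem choosePoly_eval_natCast (m k : ℕ) : (choosePoly k).eval (m : ℚ) = m.choose k := by
  have h := descPochhammer_eval_eq_descFactorial ℚ m k
  have h0 : (k.factorial : ℚ) ≠ 0 := Nat.cast_ne_zero.mpr k.factorial_ne_zero
  rw [choosePoly, Polynomial.eval_mul, Polynomial.eval_C, h, Nat.descFactorial_eq_factorial_mul_choose]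
  push_cast
  rw [inv_mul_cancel_left₀ h0]

theorem choosePoly_coeff_zero (k : ℕ) : (choosePoly (k + 1)).coeff 0 = 0 := by
  rw [choosePoly, Polynomial.mul_coeff_zero, Polynomial.coeff_zero_eq_eval_zero (descPochhammer _ _),
    descPochhammer_ne_zero_eval_zero _ (Nat.succ_ne_zero k), mul_zero]

theorem choosePoly_zero : choosePoly 0 = 1 := by simp [choosePoly]

theorem choosePoly_one : choosePoly 1 = Polynomial.X := by simp [choosePoly]

variable {A : Type u} [LeftBrace A] [LinearBrace ℚ A]

/-- The affine representation of `(A, ∘)`, on `A × ℚ`. -/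
def affineRep : A →* Module.End ℚ (A × ℚ) where
  toFun a :=
    { toFun := fun v => (lam a v.1 + v.2 • a, v.2)
      map_add' := fun v w => by
        ext
        · simp only [Prod.fst_add, Prod.snd_add, map_add, add_smul]
          abel
        · rfl
      map_smul' := fun e v => by
        ext
        · simp [mul_smul]
        · rfl }
  map_one' := by
    refine LinearMap.ext fun v => ?_
    simp [brace_one_eq_zero, lam_zero]
  map_mul' a b := by
    refine LinearMap.ext fun v => Prod.ext ?_ rfl
    change lam (a * b) v.1 + v.2 • (a * b) = lam a (lam b v.1 + v.2 • b) + v.2 • a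
    rw [map_mul, Module.End.mul_apply, mul_eq_add_lam, map_add, map_smul, smul_add]
    abel

theorem affineRep_apply (a : A) (v : A × ℚ) : affineRep a v = (lam a v.1 + v.2 • a, v.2) := rfl

theorem affineRep_apply_fst (a : A) : (affineRep a (0, 1)).1 = a := by simp [affineRep_apply]

/-- One application lands in A × 0, where `affineRep a - 1` acts as the left star by a. -/
theorem affineRep_sub_one_pow (a : A) (k : ℕ) (v : A × ℚ) :
    ((affineRep a - 1) ^ (k + 1)) v = ((starLin a ^ k) (braceStar a v.1 + v.2 • a), 0) := by
  induction k with
  | zero =>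
    ext
    · simp [affineRep_apply, lam_apply, add_assoc]
    · simp [affineRep_apply]
  | succ k ih =>
    rw [pow_succ', Module.End.mul_apply, ih, pow_succ' (starLin a)]
    simp [affineRep_apply, lam_apply, starLin_apply]

theorem starLin_pow_mem {i j : ℕ} {a b : A} (ha : a ∈ strongSub A i) (hb : b ∈ strongSub A j)
    (k : ℕ) : (starLin a ^ k) b ∈ strongSub A (j + i * k) := by
  induction k with
  | zero => simpa using hb
  | succ k ih =>
    rw [pow_succ', Module.End.mul_apply, starLin_apply,
      show j + i * (k + 1) = i + (j + i * k) by ring]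
    exact braceStar_mem ha ih

variable {n : ℕ}

theorem affineRep_sub_one_pow_eq_zero (hn : strongSub A n = ⊥) (a : A) :
    (affineRep a - 1) ^ (n + 1) = 0 := by
  refine LinearMap.ext fun v => ?_
  have h := starLin_pow_mem (mem_strongSub_one a) (mem_strongSub_one (braceStar a v.1 + v.2 • a)) n
  have h' := strongSub_antitone (show n ≤ 1 + 1 * n by omega) h
  rw [hn, Submodule.mem_bot] at h'
  rw [affineRep_sub_one_pow, h']
  rfl

/-- The powers of `affineRep a` with rational exponents. -/
noncomputable def affineRepPow (n : ℕ) (a : A) (t : ℚ) : Module.End ℚ (A × ℚ) :=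
  ∑ k ∈ Finset.range (n + 1), (choosePoly k).eval t • (affineRep a - 1) ^ k

theorem affineRepPow_natCast (hn : strongSub A n = ⊥) (a : A) (m : ℕ) :
    affineRepPow n a m = affineRep (a ^ m) := by
  have h1 : affineRep (a ^ m) = ∑ k ∈ Finset.range (m + 1),
      (choosePoly k).eval (m : ℚ) • (affineRep a - 1) ^ k := by
    rw [map_pow]
    conv_lhs => rw [← sub_add_cancel (affineRep a) 1]
    rw [(Commute.one_right _).add_pow]
    refine Finset.sum_congr rfl fun k _ => ?_
    rw [choosePoly_eval_natCast, one_pow, mul_one, ← nsmul_eq_mul', Nat.cast_smul_eq_nsmul]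
  rw [h1, affineRepPow]
  -- In this common range the terms with k > n vanish by nilpotency, those with k > m because the
  -- binomial coefficient does.
  trans ∑ k ∈ Finset.range (m + n + 1), (choosePoly k).eval (m : ℚ) • (affineRep a - 1) ^ k
  · refine Finset.sum_subset (Finset.range_mono (by omega)) fun k _ hk => ?_
    rw [pow_eq_zero_of_le (by simpa using hk) (affineRep_sub_one_pow_eq_zero hn a), smul_zero]
  · refine (Finset.sum_subset (Finset.range_mono (by omega)) fun k _ hk => ?_).symm
    rw [choosePoly_eval_natCast, Nat.choose_eq_zero_of_lt (by simpa using hk), Nat.cast_zero,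
      zero_smul]

theorem affineRepPow_mem (a : A) : affineRepPow n a ∈ polyCurves 0 ⊤ := by
  have h : affineRepPow n a = ∑ k ∈ Finset.range (n + 1),
      fun t => (choosePoly k).eval t • (affineRep a - 1) ^ k := by
    ext1 t
    rw [Finset.sum_apply]
    rfl
  rw [h]
  exact sum_mem fun k _ => eval_smul_mem_polyCurves_zero _ trivial

theorem affineRepPow_add (hn : strongSub A n = ⊥) (a : A) (s t : ℚ) :
    affineRepPow n a (s + t) = affineRepPow n a s * affineRepPow n a t := by
  -- Polynomial identities need checking only at natural numbers, so first one exponent and then the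
  -- other is freed.
  have h1 : ∀ (m : ℕ) (t : ℚ),
      affineRepPow n a (t + m) = affineRepPow n a t * affineRepPow n a m := by
    intro m
    refine congrFun (eq_of_forall_nat (P := ⊤) (c := fun t => affineRepPow n a (t + m))
      (d := fun t => affineRepPow n a t * affineRepPow n a m) ?_ ?_ ?_)
    · have h := comp_mem_polyCurves (Polynomial.X + Polynomial.C (m : ℚ)) (affineRepPow_mem (n := n) a)
      simpa only [Polynomial.eval_add, Polynomial.eval_X, Polynomial.eval_C] using h
    · exact map_mem_polyCurves (P' := ⊤) (LinearMap.mulRight ℚ (affineRepPow n a m)) (fun _ _ => trivial)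
        (affineRepPow_mem a)
    · intro l
      rw [← Nat.cast_add, affineRepPow_natCast hn, affineRepPow_natCast hn,
        affineRepPow_natCast hn, pow_add, map_mul]
  refine congrFun (eq_of_forall_nat (P := ⊤) (c := fun t => affineRepPow n a (s + t))
      (d := fun t => affineRepPow n a s * affineRepPow n a t) ?_ ?_ fun m => h1 m s) t
  · have h := comp_mem_polyCurves (Polynomial.C s + Polynomial.X) (affineRepPow_mem (n := n) a)
    simpa only [Polynomial.eval_add, Polynomial.eval_X, Polynomial.eval_C] using h
  · exact map_mem_polyCurves (P' := ⊤) (LinearMap.mulLeft ℚ (affineRepPow n a s)) (fun _ _ => trivial)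
        (affineRepPow_mem a)

theorem affineRepPow_pow (hn : strongSub A n = ⊥) (a : A) (q : ℕ) (t : ℚ) :
    affineRepPow n (a ^ q) t = affineRepPow n a (q * t) := by
  refine congrFun (eq_of_forall_nat (P := ⊤) (c := affineRepPow n (a ^ q))
      (d := fun t => affineRepPow n a (q * t)) (affineRepPow_mem _)
      (comp_mul_mem_polyCurves _ (affineRepPow_mem _)) fun m => ?_) t
  rw [← Nat.cast_mul, affineRepPow_natCast hn, affineRepPow_natCast hn, pow_mul]

/-- The one-parameter subgroup of `(A, ∘)` through `a`. -/
noncomputable def oneParam (n : ℕ) (a : A) (t : ℚ) : A := (affineRepPow n a t (0, 1)).1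

theorem affineRep_oneParam (hn : strongSub A n = ⊥) (a : A) (t : ℚ) :
    affineRep (oneParam n a t) = affineRepPow n a t := by
  suffices h : ∃ c, affineRepPow n a t = affineRep c by
    obtain ⟨c, hc⟩ := h
    rw [oneParam, hc, affineRep_apply_fst]
  -- If y^q = a, the power with exponent m / q is the image of y^m.
  have hpos : ∀ (m q : ℕ), q ≠ 0 → ∃ c, affineRepPow n a (m / q) = affineRep c := by
    intro m q hq
    obtain ⟨y, rfl⟩ := exists_root hn hq a
    refine ⟨y ^ m, ?_⟩
    rw [affineRepPow_pow hn, mul_div_cancel₀ _ (Nat.cast_ne_zero.mpr hq), affineRepPow_natCast hn]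
  have hnn : ∀ t : ℚ, 0 ≤ t → ∃ c, affineRepPow n a t = affineRep c := by
    intro t ht
    have := hpos t.num.toNat t.den t.den_nz
    rwa [show ((t.num.toNat : ℕ) : ℚ) = ((t.num.toNat : ℤ) : ℚ) from rfl,
      Int.toNat_of_nonneg (Rat.num_nonneg.mpr ht), Rat.num_div_den] at this
  rcases le_total 0 t with ht | ht
  · exact hnn t ht
  · obtain ⟨c, hc⟩ := hnn (-t) (neg_nonneg.mpr ht)
    refine ⟨c⁻¹, ?_⟩
    have h1 := affineRepPow_add hn a (-t) t
    have h2 := affineRepPow_natCast hn a 0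
    rw [Nat.cast_zero, pow_zero, map_one] at h2
    rw [neg_add_cancel, h2, hc] at h1
    calc affineRepPow n a t = affineRep (c⁻¹ * c) * affineRepPow n a t := by
          rw [inv_mul_cancel, map_one, one_mul]
      _ = affineRep c⁻¹ := by rw [map_mul, mul_assoc, ← h1, mul_one]

theorem affineRepPow_apply (a : A) (t : ℚ) (v : A × ℚ) :
    affineRepPow n a t v = (v.1 + ∑ k ∈ Finset.range n,
      (choosePoly (k + 1)).eval t • (starLin a ^ k) (braceStar a v.1 + v.2 • a), v.2) := by
  rw [affineRepPow, Finset.sum_range_succ', LinearMap.add_apply, LinearMap.sum_apply]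
  simp only [LinearMap.smul_apply, affineRep_sub_one_pow]
  ext
  · simp [choosePoly_zero, Prod.fst_sum, add_comm]
  · simp [choosePoly_zero, Prod.snd_sum]

theorem oneParam_eq (a : A) (t : ℚ) : oneParam n a t =
    ∑ k ∈ Finset.range n, (choosePoly (k + 1)).eval t • (starLin a ^ k) a := by
  have h : braceStar a 0 = 0 := map_zero (starLin a)
  simp [oneParam, affineRepPow_apply, h]

theorem braceStar_oneParam (hn : strongSub A n = ⊥) (a : A) (t : ℚ) (b : A) :
    braceStar (oneParam n a t) b =
      ∑ k ∈ Finset.range n, (choosePoly (k + 1)).eval t • (starLin a ^ k) (braceStar a b) := by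
  have h := congrArg (fun T : Module.End ℚ (A × ℚ) => (T (b, 0)).1) (affineRep_oneParam hn a t)
  simpa [affineRep_apply, lam_apply, affineRepPow_apply] using h

end OneParameter

/-! ### Polynomial curves act polynomially -/

section PolynomialAction

variable {A : Type u} [LeftBrace A] [LinearBrace ℚ A]

/-- The operators `braceStar (c t)` depend polynomially on `t`. -/
def PolyStar (k i : ℕ) (c : ℚ → A) : Prop :=
  ∀ j, ∀ b ∈ strongSub A j, (fun t => braceStar (c t) b) ∈ polyCurves k (strongSub A (j + i))

theorem PolyStar.apply {k i : ℕ} {c : ℚ → A} (hc : PolyStar k i c) {m j : ℕ} {d : ℚ → A}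
    (hd : d ∈ polyCurves m (strongSub A j)) :
    (fun t => braceStar (c t) (d t)) ∈ polyCurves (k + m) (strongSub A (j + i)) :=
  apply_mem_polyCurves (T := fun t => starLin (c t)) (hc j) hd

theorem PolyStar.mul {k i : ℕ} {c d : ℚ → A} (hc : PolyStar k i c) (hd : PolyStar k i d) :
    PolyStar k i (fun t => c t * d t) := by
  intro j b hb
  simp only [braceStar_mul]
  exact add_mem (add_mem (hc j b hb) (hd j b hb))
    (polyCurves_mono (by omega) (strongSub_antitone (by omega)) (hc.apply (hd j b hb)))

variable {n : ℕ}

theorem PolyStar.lam_inv_mem (hn : strongSub A n = ⊥) {k i : ℕ} {c : ℚ → A} (hc : PolyStar k i c)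
    {m j : ℕ} {d : ℚ → A} (hd : d ∈ polyCurves m (strongSub A j)) :
    (fun t => lam (c t)⁻¹ (d t)) ∈ polyCurves m (strongSub A j) := by
  -- This fixed-point equation is iterated. Each round keeps the approximation polynomial and
  -- improves it by one step of the strong series, so n rounds are exact.
  have he : ∀ t, lam (c t)⁻¹ (d t) = d t - braceStar (c t) (lam (c t)⁻¹ (d t)) := by
    intro t
    rw [eq_sub_iff_add_eq, ← lam_apply, lam_lam_inv]
  have h : ∀ l : ℕ, ∃ e ∈ polyCurves m (strongSub A j),
      ∀ t, lam (c t)⁻¹ (d t) - e t ∈ strongSub A l := by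
    intro l
    induction l with
    | zero => exact ⟨0, zero_mem _, fun t => by rw [strongSub_zero]; trivial⟩
    | succ l ih =>
      obtain ⟨e, he1, he2⟩ := ih
      refine ⟨fun t => d t - braceStar (c t) (e t), sub_mem hd
        (polyCurves_mono (by omega) (strongSub_antitone (by omega)) (hc.apply he1)), fun t => ?_⟩
      have h1 := neg_mem (braceStar_mem_succ (c t) (he2 t))
      have h2 : braceStar (c t) (lam (c t)⁻¹ (d t) - e t)
        = braceStar (c t) (lam (c t)⁻¹ (d t)) - braceStar (c t) (e t) := map_sub (starLin (c t)) _ _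
      rw [h2] at h1
      convert h1 using 1
      change _ - (d t - _) = _
      conv_lhs => rw [he t]
      abel
  obtain ⟨e, he1, he2⟩ := h n
  rw [hn] at he2
  convert he1 using 1
  ext t
  exact sub_eq_zero.mp (he2 t)

theorem PolyStar.lam_inv_sub_mem (hn : strongSub A n = ⊥) {k i : ℕ} {c : ℚ → A}
    (hc : PolyStar k i c) {m j : ℕ} {d : ℚ → A} (hd : d ∈ polyCurves m (strongSub A j)) :
    (fun t => lam (c t)⁻¹ (d t) - d t) ∈ polyCurves (k + m) (strongSub A (j + i)) := by
  have h := neg_mem (hc.apply (hc.lam_inv_mem hn hd))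
  convert h using 1
  ext t
  have := lam_lam_inv (c t) (d t)
  rw [lam_apply] at this
  simp only [Pi.neg_apply]
  rw [sub_eq_iff_eq_add, eq_neg_add_iff_add_eq, add_comm]
  exact this

theorem polyStar_oneParam (hn : strongSub A n = ⊥) {k m i : ℕ} (hkm : k ≤ m)
    {v : A} (hv : v ∈ strongSub A i) : PolyStar k i (fun t => oneParam n v (t ^ m)) := by
  intro j b hb
  have h : (fun t : ℚ => braceStar (oneParam n v (t ^ m)) b) = ∑ l ∈ Finset.range n,
      fun t : ℚ => (choosePoly (l + 1)).eval (t ^ m) • (starLin v ^ l) (braceStar v b) := by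
    ext1 t
    rw [Finset.sum_apply, braceStar_oneParam hn]
  rw [h]
  refine sum_mem fun l _ => eval_smul_mem_polyCurves hkm _ (choosePoly_coeff_zero l) ?_
  refine strongSub_antitone ?_ (starLin_pow_mem (mem_strongSub_one v) (braceStar_mem hv hb) l)
  omega

/-- The first term of the binomial series is t^m v itself; all later ones contain a further star by
v. -/
theorem oneParam_sub_mem (hn : strongSub A n = ⊥) {k m i : ℕ} (hkm : k ≤ m)
    {v : A} (hv : v ∈ strongSub A i) :
    (fun t : ℚ => t ^ m • v - oneParam n v (t ^ m)) ∈ polyCurves k (strongSub A (i + 1)) := by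
  rcases n with _ | n
  · have h : ∀ x : A, x = 0 := fun x => by
      rw [← Submodule.mem_bot ℚ, ← hn, strongSub_zero]; trivial
    convert zero_mem (polyCurves k (strongSub A (i + 1))) using 1
    ext t
    exact h _
  have h : (fun t : ℚ => t ^ m • v - oneParam (n + 1) v (t ^ m)) = -∑ l ∈ Finset.range n,
      fun t : ℚ => (choosePoly (l + 1 + 1)).eval (t ^ m) • (starLin v ^ (l + 1)) v := by
    ext1 t
    rw [Pi.neg_apply, Finset.sum_apply, oneParam_eq, Finset.sum_range_succ']
    simp [choosePoly_one]
  rw [h]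
  refine neg_mem (sum_mem fun l _ => eval_smul_mem_polyCurves hkm _ (choosePoly_coeff_zero _) ?_)
  exact strongSub_antitone (by omega) (starLin_pow_mem (mem_strongSub_one v) hv (l + 1))

/-- In a strongly nilpotent `ℚ`-brace, `braceStar (c t) b` is a polynomial curve in `t` whenever
`c` is one. -/
theorem polyStar_of_mem (hn : strongSub A n = ⊥) {k i : ℕ} (hi : 1 ≤ i) {c : ℚ → A}
    (hc : c ∈ polyCurves k (strongSub A i)) : PolyStar k i c := by
  -- Downward induction on the depth i; from n on the curve is zero.
  obtain ⟨d, hd⟩ : ∃ d, n ≤ i + d := ⟨n, by omega⟩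
  induction d generalizing i c with
  | zero =>
    have h0 : strongSub A i = ⊥ := le_bot_iff.mp (hn ▸ strongSub_antitone hd)
    have hc0 : c = 0 := by
      rw [h0] at hc
      have : polyCurves k (⊥ : Submodule ℚ A) ≤ ⊥ := by
        rw [polyCurves, Submodule.span_le]
        rintro _ ⟨m, _, v, hv, rfl⟩
        rw [(Submodule.mem_bot ℚ).mp hv]
        simp only [smul_zero]
        exact zero_mem _
      exact (Submodule.mem_bot ℚ).mp (this hc)
    intro j b _
    simp only [hc0, Pi.zero_apply, braceStar_zero_left]
    exact zero_fun_mem_polyCurves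
  | succ d ih =>
    -- An arbitrary deeper error e is allowed, so that monomials can be removed one at a time: the
    -- removal disturbs only e.
    suffices h : ∀ e ∈ polyCurves k (strongSub A (i + 1)), PolyStar k i (c + e) by
      simpa using h 0 (zero_mem _)
    have hcl := mem_closure_of_mem_polyCurves hc
    clear hc
    induction hcl using AddSubmonoid.closure_induction_left with
    | zero =>
      intro e he j b hb
      rw [zero_add]
      exact polyCurves_mono le_rfl (strongSub_antitone (by omega))
        (ih (Nat.le_add_left 1 i) he (by omega) j b hb)
    | add_left x hx y hy hP =>
      obtain ⟨m, hm, v, hv, rfl⟩ := hx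
      intro e he
      have hy' : y ∈ polyCurves k (strongSub A i) := by
        have : AddSubmonoid.closure {c : ℚ → A | ∃ m, k ≤ m ∧ ∃ v ∈ strongSub A i,
          c = fun t => t ^ m • v} ≤ (polyCurves k (strongSub A i)).toAddSubmonoid :=
          AddSubmonoid.closure_le.mpr Submodule.subset_span
        exact this hy
      have hγ := polyStar_oneParam hn hm hv
      have he' := add_mem (oneParam_sub_mem hn hm hv) he
      have hd' : y + ((fun t : ℚ => t ^ m • v - oneParam n v (t ^ m)) + e)
          ∈ polyCurves k (strongSub A i) :=
        add_mem hy' (polyCurves_mono le_rfl (strongSub_antitone (Nat.le_succ i)) he')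
      -- With γ the one-parameter curve of v, x + y + e = γ ∘ λ_γ⁻¹(y + (x - γ) + e). Applying λ_γ⁻¹
      -- changes its argument only at depth i + i, which is at least i + 1 since i ≥ 1; the change
      -- joins the error.
      have h1 := polyCurves_mono (show k ≤ k + k by omega) (strongSub_antitone
        (show i + 1 ≤ i + i by omega)) (hγ.lam_inv_sub_mem hn hd')
      have h2 := hγ.mul (hP _ (add_mem he' h1))
      convert h2 using 1
      ext t
      have h3 : y t + ((t ^ m • v - oneParam n v (t ^ m) + e t) +
          (lam (oneParam n v (t ^ m))⁻¹ (y t + (t ^ m • v - oneParam n v (t ^ m) + e t)) -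
            (y t + (t ^ m • v - oneParam n v (t ^ m) + e t)))
          ) = lam (oneParam n v (t ^ m))⁻¹ (y t + (t ^ m • v - oneParam n v (t ^ m) + e t)) := by
        abel
      simp only [Pi.add_apply]
      rw [h3, ← add_eq_mul_lam_inv]
      abel

end PolynomialAction

/-! ### The limit product as a nilpotent pre-Lie product -/

section LimitProduct

variable {A : Type u} [LeftBrace A] [LinearBrace ℚ A] {n : ℕ}

theorem exists_hasJet_braceStar_smul (hn : strongSub A n = ⊥) {i j : ℕ} {a b : A}
    (ha : a ∈ strongSub A i) (hb : b ∈ strongSub A j) :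
    ∃ l ∈ strongSub A (i + j), HasJet (fun t : ℚ => braceStar (t • a) b) 0 l := by
  have h : (fun t : ℚ => braceStar (t • a) b) ∈ polyCurves 1 (strongSub A (i + j)) := by
    rcases Nat.eq_zero_or_pos i with rfl | hi
    · exact polyCurves_mono le_rfl (strongSub_antitone (by omega))
        (polyStar_of_mem hn le_rfl (linear_mem_polyCurves (mem_strongSub_one a)) j b hb)
    · rw [add_comm i j]
      exact polyStar_of_mem hn hi (linear_mem_polyCurves ha) j b hb
  obtain ⟨v₀, -, v₁, hv, h1, h2⟩ := exists_hasJet h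
  rw [h2 le_rfl] at h1
  exact ⟨v₁, hv, h1⟩

theorem existsUnique_limit (hn : strongSub A n = ⊥) (a b : A) : ∃! l : A,
    FinConverges (fun n : ℕ => (2 ^ n : ℚ) • braceStar ((1 / 2 ^ n : ℚ) • a) b) l := by
  obtain ⟨l, -, hl⟩ := exists_hasJet_braceStar_smul hn (mem_strongSub_one a) (mem_strongSub_one b)
  exact ⟨l, finConverges_of_hasJet hl, fun l' hl' => hl'.unique (finConverges_of_hasJet hl)⟩

theorem polyStar_of_hasJet (hn : strongSub A n = ⊥) {c : ℚ → A} {x : A} (hc : HasJet c 0 x) : PolyStar 1 1 c :=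
  polyStar_of_mem hn le_rfl (by rw [strongSub_one]; exact hc.mem_one)

theorem hasJet_lam_inv (hn : strongSub A n = ⊥) {c d : ℚ → A} {x y : A} (hc : HasJet c 0 x) (hd : HasJet d 0 y) :
    HasJet (fun t => lam (c t)⁻¹ (d t)) 0 y := by
  have h := (polyStar_of_hasJet hn hc).lam_inv_sub_mem hn (m := 1) (j := 1) (d := d)
    (by rw [strongSub_one]; exact hd.mem_one)
  have h' := hd.add (hasJet_of_mem (polyCurves_mono le_rfl le_top h))
  simpa using h'

theorem hasJet_braceStar_braceStar (hn : strongSub A n = ⊥) {c d : ℚ → A} {x y : A}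
    (hc : HasJet c 0 x) (hd : HasJet d 0 y) (b : A) :
    HasJet (fun t => braceStar (c t) (braceStar (d t) b)) 0 0 := by
  have h1 : (fun t => braceStar (d t) b) ∈ polyCurves 1 (strongSub A (1 + 1)) :=
    polyStar_of_hasJet hn hd 1 b (mem_strongSub_one b)
  have h2 := (polyStar_of_hasJet hn hc).apply h1
  exact hasJet_of_mem (polyCurves_mono le_rfl le_top h2)

namespace IsLimitProduct

variable {dot : A → A → A} (hd : IsLimitProduct dot) (hn : strongSub A n = ⊥)

include hd hn

theorem hasJet_and_mem {i j : ℕ} {a b : A} (ha : a ∈ strongSub A i) (hb : b ∈ strongSub A j) :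
    HasJet (fun t : ℚ => braceStar (t • a) b) 0 (dot a b) ∧ dot a b ∈ strongSub A (i + j) := by
  obtain ⟨l, hm, hl⟩ := exists_hasJet_braceStar_smul hn ha hb
  have : dot a b = l := (hd a b).unique (finConverges_of_hasJet hl)
  exact this ▸ ⟨hl, hm⟩

theorem hasJet (a b : A) : HasJet (fun t : ℚ => braceStar (t • a) b) 0 (dot a b) :=
  (hd.hasJet_and_mem hn (mem_strongSub_one a) (mem_strongSub_one b)).1

theorem dot_mem {i j : ℕ} {a b : A} (ha : a ∈ strongSub A i) (hb : b ∈ strongSub A j) :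
    dot a b ∈ strongSub A (i + j) :=
  (hd.hasJet_and_mem hn ha hb).2

/-- The chain rule: the derivative at `0` of `braceStar (c t) b` depends only on that of `c`. -/
theorem hasJet_comp {c : ℚ → A} {x : A} (hc : HasJet c 0 x) (b : A) :
    HasJet (fun t => braceStar (c t) b) 0 (dot x b) := by
  have hl := hasJet_linear x
  -- Here c(t) = tx ∘ λ_{tx}⁻¹(c(t) - tx), and the second factor stays of order two.
  have hr : (fun t => c t - 0 - t • x) ∈ polyCurves 2 (strongSub A 1) := by
    rw [strongSub_one]; exact hc
  have hr' := (polyStar_of_hasJet hn hl).lam_inv_mem hn hr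
  have h2 := hasJet_of_mem (polyCurves_mono le_rfl le_top
    (polyStar_of_mem hn le_rfl hr' 1 b (mem_strongSub_one b)))
  have h3 := hasJet_braceStar_braceStar hn hl
    (hasJet_of_mem (polyCurves_mono le_rfl le_top hr')) b
  have h4 := ((hd.hasJet hn x b).add h2).add h3
  simp only [← braceStar_mul, ← add_eq_mul_lam_inv] at h4
  simpa using h4

theorem hasJet_lam_comp {c : ℚ → A} {x : A} (hc : HasJet c 0 x) (b : A) :
    HasJet (fun t => lam (c t) b) b (dot x b) := by
  simpa [lam_apply] using (hasJet_const b).add (hd.hasJet_comp hn hc b)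

/-- Since t(a + b) = ta ∘ λ_{ta}⁻¹(tb), the star by it is a sum of two stars and a composite of
order two; the second circle factor has velocity b. -/
theorem dot_add_left (a b c : A) : dot (a + b) c = dot a c + dot b c := by
  have ha := hasJet_linear a
  have hb := hasJet_lam_inv hn ha (hasJet_linear b)
  have h := ((hd.hasJet hn a c).add (hd.hasJet_comp hn hb c)).add
    (hasJet_braceStar_braceStar hn ha hb c)
  simp only [← braceStar_mul, ← add_eq_mul_lam_inv, ← smul_add, add_zero] at h
  exact ((hd.hasJet hn (a + b) c).unique h).2

theorem dot_add_right (a b c : A) : dot a (b + c) = dot a b + dot a c := by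
  have h := (hd.hasJet hn a b).add (hd.hasJet hn a c)
  simp only [← braceStar_add, add_zero] at h
  exact ((hd.hasJet hn a (b + c)).unique h).2

theorem dot_smul_right (e : ℚ) (a b : A) : dot a (e • b) = e • dot a b := by
  have h := (hd.hasJet hn a b).map (e • LinearMap.id)
  simp only [LinearMap.smul_apply, LinearMap.id_apply, ← LinearBrace.braceStar_smul,
    smul_zero] at h
  exact ((hd.hasJet hn a (e • b)).unique h).2

theorem dot_smul_left (e : ℚ) (a b : A) : dot (e • a) b = e • dot a b := by
  have h := comp_mul_mem_polyCurves e (hd.hasJet hn a b)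
  refine ((hd.hasJet hn (e • a) b).unique (w₀ := 0) ?_).2
  unfold HasJet
  convert h using 1
  ext t
  simp only [smul_smul, mul_comm]

/-- The limit product as a bilinear map. -/
noncomputable def toBilin : A →ₗ[ℚ] A →ₗ[ℚ] A :=
  LinearMap.mk₂ ℚ dot (hd.dot_add_left hn) (hd.dot_smul_left hn) (hd.dot_add_right hn)
    (fun e a b => hd.dot_smul_right hn e a b)

theorem toBilin_apply (a b : A) : hd.toBilin hn a b = dot a b := rfl

/-- Equivariance of the limit product under conjugation in `(A, ∘)`. -/
theorem dot_lam (g y z : A) : dot (lam g (y + dot y g⁻¹)) (lam g z) = lam g (dot y z) := by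
  have hc : HasJet (fun t : ℚ => g * ((t • y) * g⁻¹)) 0 (lam g (y + dot y g⁻¹)) := by
    have h := ((hasJet_linear y).add (hd.hasJet hn y g⁻¹)).map (lam g)
    rw [add_zero, map_zero] at h
    convert h using 1
    ext t
    -- This cancels the constant term, so the conjugated curve starts at 0.
    have hg : g + lam g g⁻¹ = 0 := by
      rw [← mul_eq_add_lam, mul_inv_cancel, brace_one_eq_zero]
    rw [mul_eq_add_lam, mul_eq_add_braceStar, map_add, map_add, map_add, ← sub_eq_zero, ← hg]
    abel
  have h1 := hd.hasJet_comp hn hc (lam g z)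
  have h2 := (hd.hasJet hn y z).map (lam g)
  rw [map_zero] at h2
  refine (h1.unique (w₀ := 0) ?_).2
  convert h2 using 1
  ext t
  have h3 : lam (g * ((t • y) * g⁻¹)) (lam g z) = lam g (lam (t • y) z) := by
    rw [← Module.End.mul_apply, ← Module.End.mul_apply, ← map_mul, ← map_mul]
    simp [mul_assoc]
  rw [lam_apply (g * _), lam_apply (t • y), map_add] at h3
  exact add_left_cancel h3

/-- Equivariance under g = sx is differentiated at s = 0. The transported left factor has derivative
x·y - y·x, which gives y·(x·z) + (x·y - y·x)·z = x·(y·z). -/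
theorem pre_lie (x y z : A) :
    dot (dot x y) z - dot x (dot y z) = dot (dot y x) z - dot y (dot x z) := by
  set B := hd.toBilin hn with hB
  have hB' : ∀ a b, dot a b = B a b := fun _ _ => rfl
  have hx := hasJet_linear x
  have hlam := hd.hasJet_lam_comp hn hx
  have hinv : HasJet (fun s : ℚ => (s • x)⁻¹) 0 (-x) := by
    have h := (hasJet_lam_inv hn hx hx).neg
    simp only [← brace_inv_eq, neg_zero] at h
    exact h
  have h1 : HasJet (fun s : ℚ => y + dot y (s • x)⁻¹) y (-dot y x) := by
    have h := (hasJet_const y).add (hinv.map (B y))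
    simpa [hB'] using h
  have h2 : HasJet (fun s : ℚ => lam (s • x) (y + dot y (s • x)⁻¹)) y (-dot y x + dot x y) :=
    HasJet.apply (T₁ := id) hlam h1
  have h3 : HasJet (fun s : ℚ => B (lam (s • x) (y + dot y (s • x)⁻¹)) (lam (s • x) z))
      (B y z) (B y (dot x z) + B (-dot y x + dot x y) z) :=
    HasJet.apply (T₁ := fun v => B y v) (T₂ := fun v => B (-dot y x + dot x y) v)
      (fun v => h2.map (B.flip v)) (hlam z)
  have h4 : (fun s : ℚ => B (lam (s • x) (y + dot y (s • x)⁻¹)) (lam (s • x) z))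
      = fun s : ℚ => lam (s • x) (dot y z) := funext fun s => hd.dot_lam hn (s • x) y z
  rw [h4] at h3
  have h5 := (h3.unique (hlam (dot y z))).2
  rw [map_add, map_neg, LinearMap.add_apply, LinearMap.neg_apply] at h5
  change dot y (dot x z) + (-dot (dot y x) z + dot (dot x y) z) = _ at h5
  rw [← h5]
  abel

theorem isPreLieProduct : IsPreLieProduct dot where
  add_left := hd.dot_add_left hn
  add_right := hd.dot_add_right hn
  smul_left := hd.dot_smul_left hn
  smul_right := hd.dot_smul_right hn
  pre_lie := hd.pre_lie hn

theorem evalWord_mem {X : Type*} (f : X → A) (w : FreeMagma X) :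
    evalWord dot f w ∈ strongSub A w.length := by
  induction w using FreeMagma.rec with
  | of x => exact mem_strongSub_one _
  | mul u v hu hv => exact hd.dot_mem hn hu hv

theorem evalWord_eq_zero {X : Type*} (f : X → A) {w : FreeMagma X} (hw : n ≤ w.length) :
    evalWord dot f w = 0 := by
  have h := strongSub_antitone hw (hd.evalWord_mem hn f w)
  rwa [hn, Submodule.mem_bot] at h

theorem isNilpotentProduct : IsNilpotentProduct dot :=
  ⟨n, fun _ hw => hd.evalWord_eq_zero hn id hw⟩

end IsLimitProduct

end LimitProduct

/-! ### The flow equation and the map W -/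

section Flow

variable {A : Type u} [LeftBrace A] [LinearBrace ℚ A] {n : ℕ}

theorem finsum_eq_sum_range {M : Type*} [AddCommMonoid M] {f : ℕ → M} {m : ℕ}
    (h : ∀ k, m ≤ k → f k = 0) : ∑ᶠ k, f k = ∑ k ∈ Finset.range m, f k := by
  refine finsum_eq_sum_of_support_subset _ fun k hk => ?_
  by_contra hk'
  exact hk (h k (by simpa using hk'))

/-- The exponential series of a nilpotent endomorphism, with parameter `t`. -/
theorem hasJet_exp {V : Type*} [AddCommGroup V] [Module ℚ V] {M : Module.End ℚ V} {m : ℕ}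
    (hM : M ^ m = 0) (v : V) :
    HasJet (fun t : ℚ => IsNilpotent.exp (t • M) v) v (M v) := by
  have hM' : M ^ (m + 2) = 0 := pow_eq_zero_of_le (by omega) hM
  unfold HasJet
  have h : (fun t : ℚ => IsNilpotent.exp (t • M) v - v - t • M v) =
      ∑ k ∈ Finset.range m,
        ((k + 2).factorial : ℚ)⁻¹ • fun t : ℚ => t ^ (k + 2) • (M ^ (k + 2)) v := by
    ext1 t
    rw [IsNilpotent.exp_eq_sum (k := m + 2) (by rw [smul_pow, hM', smul_zero]),
      Finset.sum_range_succ', Finset.sum_range_succ', Finset.sum_apply]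
    simp [smul_pow, add_assoc]
    abel
  rw [h]
  exact sum_mem fun k _ => Submodule.smul_mem _ _ (monomial_mem_polyCurves (by omega) trivial)

namespace IsLimitProduct

variable {dot : A → A → A} (hd : IsLimitProduct dot) (hn : strongSub A n = ⊥)

include hd hn

/-- The infinitesimal generator of the affine representation in the direction `x`. -/
noncomputable def affineGen (x : A) : Module.End ℚ (A × ℚ) :=
  LinearMap.inl ℚ A ℚ ∘ₗ
    (hd.toBilin hn x ∘ₗ LinearMap.fst ℚ A ℚ + (LinearMap.snd ℚ A ℚ).smulRight x)

theorem affineGen_apply (x : A) (v : A × ℚ) :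
    hd.affineGen hn x v = (dot x v.1 + v.2 • x, 0) := rfl

theorem affineGen_pow (x : A) (k : ℕ) (v : A × ℚ) :
    (hd.affineGen hn x ^ (k + 1)) v = ((dot x)^[k] (dot x v.1 + v.2 • x), 0) := by
  induction k with
  | zero => simp [affineGen_apply]
  | succ k ih =>
    rw [pow_succ', Module.End.mul_apply, ih, affineGen_apply, Function.iterate_succ_apply']
    simp

theorem iterate_mem {j : ℕ} (x : A) {b : A} (hb : b ∈ strongSub A j) (k : ℕ) :
    (dot x)^[k] b ∈ strongSub A (j + k) := by
  induction k with
  | zero => exact hb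
  | succ k ih =>
    rw [Function.iterate_succ_apply', show j + (k + 1) = 1 + (j + k) by ring]
    exact hd.dot_mem hn (mem_strongSub_one x) ih

theorem iterate_eq_zero (x b : A) {k : ℕ} (hk : n ≤ k) : (dot x)^[k] b = 0 := by
  have h := strongSub_antitone (show n ≤ 1 + k by omega)
    (hd.iterate_mem hn x (mem_strongSub_one b) k)
  rwa [hn, Submodule.mem_bot] at h

theorem affineGen_pow_eq_zero (x : A) : hd.affineGen hn x ^ (n + 1) = 0 := by
  refine LinearMap.ext fun v => ?_
  rw [affineGen_pow, hd.iterate_eq_zero hn _ _ le_rfl]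
  rfl

theorem exp_affineGen (x : A) (v : A × ℚ) : IsNilpotent.exp (hd.affineGen hn x) v =
    (v.1 + ∑ k ∈ Finset.range n,
      ((k + 1).factorial : ℚ)⁻¹ • (dot x)^[k] (dot x v.1 + v.2 • x), v.2) := by
  rw [IsNilpotent.exp_eq_sum (hd.affineGen_pow_eq_zero hn x), Finset.sum_range_succ',
    LinearMap.add_apply, LinearMap.sum_apply]
  simp only [LinearMap.smul_apply, affineGen_pow]
  ext
  · simp [Prod.fst_sum, add_comm]
  · simp [Prod.snd_sum]

theorem flowW_eq (x : A) : flowW dot x =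
    ∑ k ∈ Finset.range n, ((k + 1).factorial : ℚ)⁻¹ • (dot x)^[k] x :=
  finsum_eq_sum_range fun k hk => by rw [hd.iterate_eq_zero hn _ _ hk, smul_zero]

theorem expLeft_eq (x b : A) : expLeft dot x b =
    b + ∑ k ∈ Finset.range n, ((k + 1).factorial : ℚ)⁻¹ • (dot x)^[k] (dot x b) := by
  rw [expLeft, finsum_eq_sum_range (m := n + 1) fun k hk => by
    rw [hd.iterate_eq_zero hn _ _ (by omega), smul_zero], Finset.sum_range_succ']
  simp [add_comm]

theorem dot_zero_right (x : A) : dot x 0 = 0 := map_zero (hd.toBilin hn x)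

/-- The flow equation for the one-parameter subgroups of `(A, ∘)`. -/
theorem affineRep_eq_exp (a : A) : ∃ x, affineRep a = IsNilpotent.exp (hd.affineGen hn x) := by
  have hγ : (fun t : ℚ => oneParam n a t) ∈ polyCurves 1 (⊤ : Submodule ℚ A) := by
    have h1 := polyCurves_mono le_rfl le_top
      (oneParam_sub_mem hn (k := 1) (m := 1) le_rfl (mem_strongSub_one a))
    have h2 := sub_mem (linear_mem_polyCurves (P := (⊤ : Submodule ℚ A)) (v := a) trivial) h1
    convert h2 using 1
    ext t
    simp
  obtain ⟨v₀, -, x, -, hx, h0⟩ := exists_hasJet hγ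
  rw [h0 le_rfl] at hx
  clear h0 v₀
  refine ⟨x, LinearMap.ext fun v => ?_⟩
  set M := hd.affineGen hn x with hM
  have hM0 : M ^ (n + 1) = 0 := hd.affineGen_pow_eq_zero hn x
  have hnil : ∀ t : ℚ, IsNilpotent (t • M) := fun t =>
    ⟨n + 1, by rw [smul_pow, hM0, smul_zero]⟩
  have hadd : ∀ s t : ℚ, IsNilpotent.exp ((s + t) • M)
      = IsNilpotent.exp (s • M) * IsNilpotent.exp (t • M) := fun s t => by
    rw [add_smul, IsNilpotent.exp_add_of_commute
      (((Commute.refl M).smul_right t).smul_left s) (hnil s) (hnil t)]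
  have hU : ∀ w : A × ℚ, HasJet (fun t => affineRepPow n a t w) w (M w) := by
    intro w
    have h1 := (hd.hasJet_lam_comp hn hx w.1).add (hx.map (w.2 • LinearMap.id))
    have h2 := (h1.map (LinearMap.inl ℚ A ℚ)).add (hasJet_const ((0 : A), w.2))
    convert h2 using 1
    · ext1 t
      rw [← affineRep_oneParam hn, affineRep_apply]
      simp
    · simp
    · simp [hM, affineGen_apply]
  have hE : ∀ w : A × ℚ, HasJet (fun t : ℚ => IsNilpotent.exp ((-t) • M) w) w (-M w) := by
    intro w
    have h := hasJet_exp (M := (-1 : ℚ) • M) (m := n + 1) (by rw [smul_pow, hM0, smul_zero]) w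
    simp only [smul_smul, mul_neg_one] at h
    rwa [LinearMap.smul_apply, neg_one_smul] at h
  -- With U the rational powers of `affineRep a`, the curve e^{-sM} U(s) v has zero derivative: by
  -- the two addition laws this reduces to s = 0, where the velocities M and -M cancel.
  have hf := eq_const_of_hasJet
    (c := fun s : ℚ => IsNilpotent.exp ((-s) • M) (affineRepPow n a s v)) (fun s => by
      have h1 := (HasJet.apply (T₁ := id) hE (hU (affineRepPow n a s v))).map
        (IsNilpotent.exp ((-s) • M))
      simp only [id] at h1
      rw [add_neg_cancel, map_zero] at h1
      convert h1 using 1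
      ext1 t
      rw [neg_add, hadd, add_comm s t, affineRepPow_add hn]
      rfl) 1
  have hU0 := affineRepPow_natCast hn a 0
  have hU1 := affineRepPow_natCast hn a 1
  rw [Nat.cast_zero, pow_zero, map_one] at hU0
  rw [Nat.cast_one, pow_one] at hU1
  simp only [hU0, hU1, neg_zero, zero_smul, IsNilpotent.exp_zero, Module.End.one_apply] at hf
  calc affineRep a v
      = IsNilpotent.exp ((1 : ℚ) • M) (IsNilpotent.exp ((-1 : ℚ) • M) (affineRep a v)) := by
        rw [← Module.End.mul_apply, ← hadd, add_neg_cancel, zero_smul, IsNilpotent.exp_zero,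
          Module.End.one_apply]
    _ = IsNilpotent.exp M v := by rw [hf, one_smul]

theorem exists_flow (a : A) : ∃ x, flowW dot x = a ∧ ∀ b, lam a b = expLeft dot x b := by
  obtain ⟨x, hx⟩ := hd.affineRep_eq_exp hn a
  refine ⟨x, ?_, fun b => ?_⟩
  · have h := congrArg (fun T : Module.End ℚ (A × ℚ) => (T (0, 1)).1) hx
    simp only [affineRep_apply_fst, exp_affineGen, hd.dot_zero_right hn] at h
    rw [h, hd.flowW_eq hn]
    simp
  · have h := congrArg (fun T : Module.End ℚ (A × ℚ) => (T (b, 0)).1) hx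
    simp only [affineRep_apply, exp_affineGen] at h
    rw [hd.expLeft_eq hn]
    simpa using h

theorem flowW_bijective : Function.Bijective (flowW dot) := by
  refine bijective_of_approx hn (flowW dot) one_ne_zero fun i x y hxy => ?_
  -- Telescoping: in each step either the old difference is multiplied by x, or x - y multiplies an
  -- iterate of y.
  have hit : ∀ k, (dot x)^[k] x - (dot y)^[k] y ∈ strongSub A (i + k) := by
    intro k
    induction k with
    | zero => exact hxy
    | succ k ih =>
      rw [Function.iterate_succ_apply', Function.iterate_succ_apply']
      have h1 := hd.dot_mem hn (mem_strongSub_one x) ih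
      have h2 := hd.dot_mem hn hxy (hd.iterate_mem hn y (mem_strongSub_one y) k)
      have h3 := add_mem (strongSub_antitone (show i + (k + 1) ≤ 1 + (i + k) by omega) h1)
        (strongSub_antitone (show i + (k + 1) ≤ i + (1 + k) by omega) h2)
      have e1 : dot x ((dot x)^[k] x - (dot y)^[k] y)
        = dot x ((dot x)^[k] x) - dot x ((dot y)^[k] y) := map_sub (hd.toBilin hn x) _ _
      have e2 : dot (x - y) ((dot y)^[k] y)
        = dot x ((dot y)^[k] y) - dot y ((dot y)^[k] y) := LinearMap.map_sub₂ (hd.toBilin hn) _ _ _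
      rw [e1, e2] at h3
      simpa using h3
  -- The bound n + 1 ensures that the sum has a term k = 0 to split off, even for n = 0.
  have hn1 : strongSub A (n + 1) = ⊥ := le_bot_iff.mp (hn ▸ strongSub_antitone (Nat.le_succ n))
  rw [hd.flowW_eq hn1, hd.flowW_eq hn1, ← Finset.sum_sub_distrib, Finset.sum_range_succ']
  simp only [← smul_sub]
  have h : ∑ k ∈ Finset.range n, ((k + 1 + 1).factorial : ℚ)⁻¹ •
      ((dot x)^[k + 1] x - (dot y)^[k + 1] y) ∈ strongSub A (i + 1) :=
    sum_mem fun k _ => Submodule.smul_mem _ _ (strongSub_antitone (by omega) (hit (k + 1)))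
  convert h using 1
  simp

theorem flowOmega_flowW (x : A) : flowOmega dot (flowW dot x) = x :=
  Function.leftInverse_invFun (hd.flowW_bijective hn).1 x

theorem lam_eq_expLeft (a b : A) : lam a b = expLeft dot (flowOmega dot a) b := by
  obtain ⟨x, rfl, hx⟩ := hd.exists_flow hn a
  rw [hd.flowOmega_flowW hn, hx]

theorem mul_eq_flowMul (a b : A) : a * b = flowMul dot a b := by
  rw [mul_eq_add_lam, hd.lam_eq_expLeft hn]
  rfl

end IsLimitProduct

end Flow

/-! ### Universal coefficients on bracketed words -/

section Words

/-- The coefficient of the word `w` in `L_Ω^k(Ω)`, for the formal series `Ω = Ω(a)`. -/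
def omegaCoeff : FreeMagma Bool → ℕ → ℚ
  | .of x => fun k => if x = false ∧ k = 0 then 1 else 0
  | .mul u v => fun k => match k with
    -- W(Ω) = a reads Ω = a - ∑ L_Ω^{k+1}(Ω)/(k+2)!, and the coefficient of uv in L_Ω^{k+1}(Ω) is
    -- that of u in Ω times that of v in L_Ω^k(Ω). The latter vanishes once k reaches the length of
    -- v.
    | 0 => -(omegaCoeff u 0 *
        ∑ k ∈ Finset.range v.length, ((k + 2).factorial : ℚ)⁻¹ * omegaCoeff v k)
    | k + 1 => omegaCoeff u 0 * omegaCoeff v k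

/-- The coefficient of the word `w` in `L_Ω^k(b)`, for the formal series `Ω = Ω(a)`. -/
def expCoeff : FreeMagma Bool → ℕ → ℚ
  | .of x => fun k => if x = true ∧ k = 0 then 1 else 0
  | .mul u v => fun k => match k with
    | 0 => 0
    | k + 1 => omegaCoeff u 0 * expCoeff v k

/-- The coefficient of the word `w` in `e^{L_{Ω(a)}}(b)`. -/
def flowCoeff (w : FreeMagma Bool) : ℚ :=
  ∑ k ∈ Finset.range w.length, ((k.factorial : ℚ)⁻¹) * expCoeff w k

theorem freeMagma_length_mul {X : Type*} (u v : FreeMagma X) :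
    (FreeMagma.mul u v).length = u.length + v.length := rfl

theorem omegaCoeff_eq_zero (w : FreeMagma Bool) {k : ℕ} (hk : w.length ≤ k) :
    omegaCoeff w k = 0 := by
  induction w using FreeMagma.rec generalizing k with
  | of x =>
    have : k ≠ 0 := by
      change 1 ≤ k at hk
      omega
    simp [omegaCoeff, this]
  | mul u v _ hv =>
    rw [freeMagma_length_mul] at hk
    have hu := u.length_pos
    obtain ⟨k, rfl⟩ := Nat.exists_eq_add_of_le' (show 1 ≤ k by omega)
    simp [omegaCoeff, hv (show v.length ≤ k by omega)]

theorem expCoeff_eq_zero (w : FreeMagma Bool) {k : ℕ} (hk : w.length ≤ k) :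
    expCoeff w k = 0 := by
  induction w using FreeMagma.rec generalizing k with
  | of x =>
    have : k ≠ 0 := by
      change 1 ≤ k at hk
      omega
    simp [expCoeff, this]
  | mul u v _ hv =>
    rw [freeMagma_length_mul] at hk
    have hu := u.length_pos
    obtain ⟨k, rfl⟩ := Nat.exists_eq_add_of_le' (show 1 ≤ k by omega)
    simp [expCoeff, hv (show v.length ≤ k by omega)]

theorem wordLetters_of_omegaCoeff_ne_zero (w : FreeMagma Bool) {k : ℕ} (h : omegaCoeff w k ≠ 0) :
    ∃ j, wordLetters w = List.replicate j false := by
  induction w using FreeMagma.rec generalizing k with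
  | of x =>
    have hx : x = false := by
      by_contra hx
      simp [omegaCoeff, hx] at h
    exact ⟨1, by simp [wordLetters, hx]⟩
  | mul u v hu hv =>
    have huv : omegaCoeff u 0 ≠ 0 ∧ ∃ k, omegaCoeff v k ≠ 0 := by
      match k with
      | 0 =>
        have h' : omegaCoeff u 0 * ∑ k ∈ Finset.range v.length,
            ((k + 2).factorial : ℚ)⁻¹ * omegaCoeff v k ≠ 0 := neg_ne_zero.mp h
        obtain ⟨k, -, hk⟩ := Finset.exists_ne_zero_of_sum_ne_zero (right_ne_zero_of_mul h')
        exact ⟨left_ne_zero_of_mul h', k, right_ne_zero_of_mul hk⟩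
      | k + 1 => exact ⟨left_ne_zero_of_mul h, k, right_ne_zero_of_mul h⟩
    obtain ⟨i, hi⟩ := hu huv.1
    obtain ⟨j, hj⟩ := hv huv.2.choose_spec
    exact ⟨i + j, by rw [wordLetters, hi, hj, List.replicate_add]⟩

theorem wordLetters_of_expCoeff_ne_zero (w : FreeMagma Bool) {k : ℕ} (h : expCoeff w k ≠ 0) :
    ∃ j, wordLetters w = List.replicate j false ++ [true] := by
  induction w using FreeMagma.rec generalizing k with
  | of x =>
    have hx : x = true := by
      by_contra hx
      simp [expCoeff, hx] at h
    exact ⟨0, by simp [wordLetters, hx]⟩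
  | mul u v _ hv =>
    match k with
    | 0 => exact absurd rfl h
    | k + 1 =>
      obtain ⟨i, hi⟩ := wordLetters_of_omegaCoeff_ne_zero u (left_ne_zero_of_mul h)
      obtain ⟨j, hj⟩ := hv (right_ne_zero_of_mul h)
      exact ⟨i + j, by rw [wordLetters, hi, hj, List.replicate_add, List.append_assoc]⟩

theorem length_wordLetters {X : Type*} (w : FreeMagma X) : (wordLetters w).length = w.length := by
  induction w using FreeMagma.rec with
  | of x => rfl
  | mul u v hu hv => rw [wordLetters, List.length_append, hu, hv, freeMagma_length_mul]

theorem eq_of_wordLetters_eq_singleton {X : Type*} {w : FreeMagma X} {x : X}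
    (h : wordLetters w = [x]) : w = .of x := by
  cases w using FreeMagma.rec with
  | of y => rw [show y = x by simpa [wordLetters] using h]
  | mul u v =>
    have hl := congrArg List.length h
    rw [length_wordLetters, freeMagma_length_mul] at hl
    have hu := u.length_pos
    have hv := v.length_pos
    simp at hl
    omega

theorem eq_of_wordLetters_eq_pair {X : Type*} {w : FreeMagma X} {x y : X}
    (h : wordLetters w = [x, y]) : w = .mul (.of x) (.of y) := by
  cases w using FreeMagma.rec with
  | of z => simp [wordLetters] at h
  | mul u v =>
    have hl := congrArg List.length h
    rw [length_wordLetters, freeMagma_length_mul] at hl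
    have hu := u.length_pos
    have hv := v.length_pos
    simp at hl
    have h' : wordLetters u ++ wordLetters v = [x] ++ [y] := h
    obtain ⟨h1, h2⟩ := List.append_inj h' (by rw [length_wordLetters]; simp; omega)
    rw [eq_of_wordLetters_eq_singleton h1, eq_of_wordLetters_eq_singleton h2]

theorem flowCoeff_support {w : FreeMagma Bool} (h : flowCoeff w ≠ 0) (hw : w ∉ longWords) :
    w = .of true ∨ w = .mul (.of false) (.of true) := by
  obtain ⟨k, -, hk⟩ := Finset.exists_ne_zero_of_sum_ne_zero h
  obtain ⟨j, hj⟩ := wordLetters_of_expCoeff_ne_zero w (right_ne_zero_of_mul hk)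
  match j with
  | 0 => exact .inl (eq_of_wordLetters_eq_singleton hj)
  | 1 => exact .inr (eq_of_wordLetters_eq_pair hj)
  | j + 2 => exact absurd ⟨j + 2, by omega, hj⟩ hw

theorem flowCoeff_of_true : flowCoeff (.of true) = 1 := by
  simp [flowCoeff, FreeMagma.length, expCoeff]

theorem flowCoeff_mul : flowCoeff (.mul (.of false) (.of true)) = 1 := by
  simp [flowCoeff, FreeMagma.length, expCoeff, omegaCoeff, Finset.sum_range_succ]

theorem finite_length_lt {X : Type*} [Finite X] (n : ℕ) : {w : FreeMagma X | w.length < n}.Finite := by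
  induction n with
  | zero => simp
  | succ n ih =>
    refine ((Set.finite_range FreeMagma.of).union (ih.image2 FreeMagma.mul ih)).subset ?_
    intro w hw
    cases w using FreeMagma.rec with
    | of x => exact .inl ⟨x, rfl⟩
    | mul u v =>
      rw [Set.mem_ofPred_eq, freeMagma_length_mul] at hw
      have hu := u.length_pos
      have hv := v.length_pos
      exact .inr ⟨u, by rw [Set.mem_ofPred_eq]; omega, v, by rw [Set.mem_ofPred_eq]; omega, rfl⟩

/-- The words of length less than `n`. -/
noncomputable def shortWords (n : ℕ) : Finset (FreeMagma Bool) :=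
  (finite_length_lt (X := Bool) n).toFinset

theorem mem_shortWords {n : ℕ} {w : FreeMagma Bool} : w ∈ shortWords n ↔ w.length < n := by
  simp [shortWords]

variable {A : Type u} [LeftBrace A] [LinearBrace ℚ A] {n : ℕ}

/-- The value at `(a, b)` of a formal series with coefficients `f`, truncated at length `n`. -/
noncomputable def evalSeries (dot : A → A → A) (n : ℕ) (a b : A) (f : FreeMagma Bool → ℚ) : A :=
  ∑ w ∈ shortWords n, f w • evalPair dot a b w

theorem evalSeries_sum (dot : A → A → A) (a b : A) (m : ℕ) (r : ℕ → ℚ)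
    (f : ℕ → FreeMagma Bool → ℚ) :
    evalSeries dot n a b (fun w => ∑ k ∈ Finset.range m, r k * f k w) =
      ∑ k ∈ Finset.range m, r k • evalSeries dot n a b (f k) := by
  simp only [evalSeries, Finset.sum_smul, Finset.smul_sum, smul_smul]
  exact Finset.sum_comm

theorem evalSeries_single (dot : A → A → A) (a b : A) (f : FreeMagma Bool → ℚ) {x : Bool}
    (hn : 2 ≤ n) (hf : f (.of x) = 1) (hf' : ∀ w ∈ shortWords n, w ≠ .of x → f w = 0) :
    evalSeries dot n a b f = if x then b else a := by
  rw [evalSeries, Finset.sum_eq_single (.of x) (fun w hw h => by rw [hf' w hw h, zero_smul])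
    (fun h => absurd (mem_shortWords.mpr (show 1 < n by omega)) h), hf, one_smul]
  rfl

namespace IsLimitProduct

variable {dot : A → A → A} (hd : IsLimitProduct dot) (hn : strongSub A n = ⊥)

include hd hn

/-- A word of length at least two splits uniquely as a product. Truncation loses nothing, since
words of length n or more evaluate to zero. -/
theorem evalSeries_mul (a b : A) (f g h : FreeMagma Bool → ℚ) (h0 : ∀ x, h (.of x) = 0)
    (h1 : ∀ u v, h (.mul u v) = f u * g v) :
    evalSeries dot n a b h = dot (evalSeries dot n a b f) (evalSeries dot n a b g) := by
  rw [← hd.toBilin_apply hn]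
  simp only [evalSeries, map_sum, LinearMap.sum_apply, map_smul, LinearMap.smul_apply,
    Finset.smul_sum]
  rw [Finset.sum_comm (f := fun _ _ => _ • _ • _), ← Finset.sum_product']
  symm
  refine Finset.sum_bij_ne_zero (fun p _ _ => FreeMagma.mul p.1 p.2) ?_ ?_ ?_ ?_
  · rintro ⟨u, v⟩ _ hne
    rw [mem_shortWords]
    by_contra hlt
    refine hne ?_
    have := hd.evalWord_eq_zero hn (fun i => if i then b else a) (not_lt.mp hlt)
    change _ • _ • evalWord dot _ (FreeMagma.mul u v) = _
    simp only [this, smul_zero]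
  · rintro ⟨u, v⟩ _ _ ⟨u', v'⟩ _ _ he
    injection he with h h'
    exact Prod.ext h h'
  · intro w hw hne
    cases w using FreeMagma.rec with
    | of x => rw [h0, zero_smul] at hne; exact absurd rfl hne
    | mul u v =>
      rw [mem_shortWords, freeMagma_length_mul] at hw
      refine ⟨(u, v), by simp only [Finset.mem_product, mem_shortWords]; omega, ?_, rfl⟩
      rw [h1] at hne
      intro h2
      refine hne ?_
      rw [mul_comm, mul_smul]
      exact h2
  · rintro ⟨u, v⟩ _ _
    rw [h1, mul_comm, mul_smul]
    rfl

theorem iterate_evalSeries (a b : A) (f : FreeMagma Bool → ℚ) (g : ℕ → FreeMagma Bool → ℚ)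
    (h0 : ∀ k x, g (k + 1) (.of x) = 0) (h1 : ∀ k u v, g (k + 1) (.mul u v) = f u * g k v) (k : ℕ) :
    (dot (evalSeries dot n a b f))^[k] (evalSeries dot n a b (g 0)) =
      evalSeries dot n a b (g k) := by
  induction k with
  | zero => rfl
  | succ k ih =>
    rw [Function.iterate_succ_apply', ih,
      hd.evalSeries_mul hn a b f (g k) (g (k + 1)) (h0 k) (h1 k)]

theorem flowOmega_eq_evalSeries (hn2 : 2 ≤ n) (a b : A) :
    flowOmega dot a = evalSeries dot n a b (fun w => omegaCoeff w 0) := by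
  -- As W is injective, it suffices that the formal series solves W(Ω) = a; on products this is the
  -- recursion defining the coefficients.
  suffices h : flowW dot (evalSeries dot n a b (fun w => omegaCoeff w 0)) = a by
    conv_lhs => rw [← h]
    exact hd.flowOmega_flowW hn _
  rw [hd.flowW_eq hn]
  have hit := hd.iterate_evalSeries hn a b (fun w => omegaCoeff w 0) (fun k w => omegaCoeff w k)
    (fun k x => by simp [omegaCoeff]) (fun k u v => rfl)
  simp only [hit]
  rw [← evalSeries_sum dot a b n (fun k => ((k + 1).factorial : ℚ)⁻¹) (fun k w => omegaCoeff w k)]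
  obtain ⟨m, rfl⟩ := Nat.exists_eq_add_of_le' (show 1 ≤ n by omega)
  refine (evalSeries_single dot a b _ (x := false) hn2 ?_ ?_).trans (if_neg (by simp))
  · simp [omegaCoeff]
  · intro w hw hne
    cases w using FreeMagma.rec with
    | of x =>
      have hx : x ≠ false := fun h => hne (by rw [h])
      simp [omegaCoeff, hx]
    | mul u v =>
      rw [mem_shortWords, freeMagma_length_mul] at hw
      have hu := u.length_pos
      have h2 : ∑ k ∈ Finset.range v.length, ((k + 2).factorial : ℚ)⁻¹ * omegaCoeff v k
          = ∑ k ∈ Finset.range m, ((k + 2).factorial : ℚ)⁻¹ * omegaCoeff v k :=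
        Finset.sum_subset (Finset.range_mono (by omega)) fun k _ hk => by
          rw [omegaCoeff_eq_zero v (by simpa using hk), mul_zero]
      rw [Finset.sum_range_succ']
      simp only [omegaCoeff]
      rw [h2, Finset.mul_sum]
      simp [mul_left_comm, add_assoc]

theorem expLeft_eq_evalSeries (hn2 : 2 ≤ n) (a b : A) :
    expLeft dot (flowOmega dot a) b = evalSeries dot n a b flowCoeff := by
  have hit := hd.iterate_evalSeries hn a b (fun w => omegaCoeff w 0) (fun k w => expCoeff w k)
    (fun k x => by simp [expCoeff]) (fun k u v => rfl)
  have hb : evalSeries dot n a b (fun w => expCoeff w 0) = b := by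
    refine (evalSeries_single dot a b _ (x := true) hn2 ?_ ?_).trans (if_pos rfl)
    · simp [expCoeff]
    · intro w _ hne
      cases w using FreeMagma.rec with
      | of x =>
        have hx : x ≠ true := fun h => hne (by rw [h])
        simp [expCoeff, hx]
      | mul u v => rfl
  simp only [hb] at hit
  rw [hd.flowOmega_eq_evalSeries hn hn2 a b, expLeft, finsum_eq_sum_range (m := n) fun k hk => by
    rw [hd.iterate_eq_zero hn _ _ hk, smul_zero]]
  simp only [hit]
  rw [← evalSeries_sum dot a b n (fun k => (k.factorial : ℚ)⁻¹) (fun k w => expCoeff w k)]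
  refine Finset.sum_congr rfl fun w hw => ?_
  rw [mem_shortWords] at hw
  congr 1
  refine (Finset.sum_subset (Finset.range_mono hw.le) fun k _ hk => ?_).symm
  rw [expCoeff_eq_zero w (by simpa using hk), mul_zero]

theorem finite_longWords (a b : A) (β : FreeMagma Bool → ℚ) :
    (longWords ∩ {w | β w • evalPair dot a b w ≠ 0}).Finite := by
  refine (finite_length_lt (X := Bool) n).subset fun w hw => ?_
  by_contra h
  refine hw.2 ?_
  rw [evalPair, hd.evalWord_eq_zero hn _ (not_lt.mp h), smul_zero]

theorem braceStar_eq_finsum (hn3 : 3 ≤ n) (a b : A) :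
    braceStar a b = dot a b + ∑ᶠ w ∈ longWords, flowCoeff w • evalPair dot a b w := by
  classical
  have h1 : lam a b = ∑ w ∈ shortWords n, flowCoeff w • evalPair dot a b w := by
    rw [hd.lam_eq_expLeft hn, hd.expLeft_eq_evalSeries hn (by omega)]
    rfl
  have h2 : ∑ᶠ w ∈ longWords, flowCoeff w • evalPair dot a b w =
      ∑ w ∈ shortWords n with w ∈ longWords, flowCoeff w • evalPair dot a b w := by
    refine finsum_mem_eq_sum_of_inter_support_eq _ ?_
    ext w
    simp only [Set.mem_inter_iff, Finset.coe_filter, Set.mem_ofPred_eq, mem_shortWords,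
      Function.mem_support]
    refine ⟨fun h => ⟨⟨?_, h.1⟩, h.2⟩, fun h => ⟨h.1.2, h.2⟩⟩
    by_contra hlt
    refine h.2 ?_
    rw [evalPair, hd.evalWord_eq_zero hn _ (not_lt.mp hlt), smul_zero]
  -- Outside the long words only b and ab can have nonzero coefficients. Both are short enough
  -- because n ≥ 3; they contribute b, which cancels against λ_a(b) = b + a * b, and a·b.
  have h3 : ∑ w ∈ shortWords n with w ∉ longWords, flowCoeff w • evalPair dot a b w =
      ∑ w ∈ {.of true, .mul (.of false) (.of true)}, flowCoeff w • evalPair dot a b w := by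
    symm
    refine Finset.sum_subset ?_ fun w hw hw' => ?_
    · intro w hw
      rw [Finset.mem_insert, Finset.mem_singleton] at hw
      rw [Finset.mem_filter, mem_shortWords]
      rcases hw with rfl | rfl
      · refine ⟨show 1 < n by omega, ?_⟩
        rintro ⟨k, hk, h⟩
        have := congrArg List.length h
        simp [wordLetters] at this
        omega
      · refine ⟨show 2 < n by omega, ?_⟩
        rintro ⟨k, hk, h⟩
        have := congrArg List.length h
        simp [wordLetters] at this
        omega
    · rw [Finset.mem_insert, Finset.mem_singleton] at hw'
      by_contra hne
      exact hw' (flowCoeff_support (left_ne_zero_of_smul hne) (Finset.mem_filter.mp hw).2)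
  rw [← Finset.sum_filter_add_sum_filter_not _ (· ∈ longWords), h3,
    Finset.sum_pair (by simp), flowCoeff_of_true, flowCoeff_mul, one_smul, one_smul, lam_apply,
    ← h2] at h1
  have h4 : evalPair dot a b (.of true) = b := rfl
  have h5 : evalPair dot a b (.mul (.of false) (.of true)) = dot a b := rfl
  rw [h4, h5, add_left_comm] at h1
  rw [add_left_cancel h1, add_comm]

end IsLimitProduct

end Words

theorem mainTheorem2 :
    ∃ β : FreeMagma Bool → ℚ,
      ∀ (A : Type u) [LeftBrace A] [LinearBrace ℚ A], StronglyNilpotent A →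
        (∀ a b : A, ∃! l : A,
          FinConverges (fun n : ℕ => (2 ^ n : ℚ) • braceStar ((1 / 2 ^ n : ℚ) • a) b) l) ∧
        ∀ dot : A → A → A, IsLimitProduct dot →
          IsPreLieProduct dot ∧
          IsNilpotentProduct dot ∧
          Function.Bijective (flowW dot) ∧
          (∀ a b : A, a * b = flowMul dot a b) ∧
          (∀ a b : A,
            (longWords ∩ {w | β w • evalPair dot a b w ≠ 0}).Finite ∧
            braceStar a b = dot a b + ∑ᶠ w ∈ longWords, β w • evalPair dot a b w) := by
  refine ⟨flowCoeff, fun A _ _ ⟨m, hm⟩ => ?_⟩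
  -- Raising the bound by 3 keeps the words b and ab within the truncation.
  have hn : strongSub A (m + 3) = ⊥ := by
    have h : strongSub A m = ⊥ := by
      ext x
      change x ∈ strongSeries A m ↔ _
      rw [hm]
      rfl
    exact le_bot_iff.mp (h ▸ strongSub_antitone (Nat.le_add_right m 3))
  exact ⟨existsUnique_limit hn, fun dot hd => ⟨hd.isPreLieProduct hn, hd.isNilpotentProduct hn,
    hd.flowW_bijective hn, hd.mul_eq_flowMul hn, fun a b => ⟨hd.finite_longWords hn a b _,
      hd.braceStar_eq_finsum hn (Nat.le_add_left 3 m) a b⟩⟩⟩
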